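/- Let $D>0$, $p\in\mathbb R$, $c\ge 0$. A function $k\in C^2([0,1]^2)$ is called a backstepping kernel (for $D,p,c$) if the Volterra transformation $(T_kf)(z)=f(z)+\int_z^1k(z,s)f(s)\,ds$ turns the operator $y\mapsto Dy''+py$ into $x\mapsto Dx''-cx$, i.e. $D(T_ky)''-c\,T_ky=T_k(Dy''+py)$ on $(0,1)$ for every $y\in C^2([0,1])$ with $y(1)=0$. A function $l\in C^2([0,1]^2)$ is an inverse kernel of $k$ if, for all $x,y\in C^0([0,1])$, $x=T_ky$ holds on $[0,1]$ if and only if $y=T_lx$ holds on $[0,1]$. Write $\|f\|=\big(\int_0^1f^2(z)\,dz\big)^{1/2}$ and, for a kernel $\kappa$, $\|\kappa\|_{L^2}=\big(\int_0^1\int_z^1\kappa^2(z,s)\,ds\,dz\big)^{1/2}$. Put $\zeta=\sqrt{c/D}$ and $$G=\frac{\sqrt2}{\pi}\sqrt{\sum_{n=1}^\infty\frac{n^2}{(\pi^{-2}\zeta^2+n^2)^2}} .$$ Then the following hold. 1. If $c>0$, then $G=\dfrac{1}{e^{2\zeta}-1}\sqrt{\dfrac{e^{4\zeta}-1-4\zeta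 e^{2\zeta}}{2\zeta}}$; if $c=0$, then $G=1/\sqrt3$. 2. There exist a backstepping kernel $k$ and an inverse kernel $l$ of $k$. 3. Let $k$ be any backstepping kernel and $l$ an inverse kernel of $k$. For every $d\in C^2([0,\infty))$ and every $y_0\in C^2([0,1])$ with $y_0(0)=d(0)-\int_0^1k(0,s)y_0(s)\,ds$ and $y_0(1)=0$, there is exactly one function $y\in C^0([0,\infty)\times[0,1])\cap C^1((0,\infty)\times[0,1])$ with $y[t]:=y(t,\cdot)\in C^2([0,1])$ for all $t\ge0$ that satisfies $$y_t(t,z)=D\,y_{zz}(t,z)+p\,y(t,z)\quad\text{for }(t,z)\in(0,\infty)\times(0,1),$$ $$y(t,0)=d(t)-\int_0^1k(0,s)y(t,s)\,ds,\qquad y(t,1)=0\quad\text{for }t\ge0,$$ and $y(0,\cdot)=y_0$. Moreover, for all $t\ge0$ and all $\varepsilon>0$, $$\|y[t]\|\le e^{-(c+D\pi^2)t}\,(1+\|l\|_{L^2})(1+\|k\|_{L^2})\sqrt{1+\varepsilon}\,\|y_0\|+(1+\|l\|_{L^2})\sqrt{1+\varepsilon^{-1}}\;G\max_{0\le s\le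 t}|d(s)| .$$ -/

import Mathlib

open Set Real

namespace BoundaryISS

/-- The Volterra transformation `f ↦ f(z) + ∫_z^1 κ(z,s) f(s) ds` with kernel `κ`. -/
noncomputable def volterra (κ : ℝ → ℝ → ℝ) (f : ℝ → ℝ) (z : ℝ) : ℝ :=
  f z + ∫ s in z..1, κ z s * f s

/-- `κ` is of class `C²` on the square `[0,1]²`. -/
def IsC2Kernel (κ : ℝ → ℝ → ℝ) : Prop :=
  ContDiffOn ℝ 2 (fun q : ℝ × ℝ => κ q.1 q.2) (Icc 0 1 ×ˢ Icc 0 1)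

/-- `k` is a backstepping kernel: the Volterra transformation `x = volterra k y` carries
the plant operator `y ↦ D y'' + p y` (Dirichlet condition `y(1) = 0`) into the target operator
`x ↦ D x'' - c x`.  Applied to the profiles of a trajectory, this says that `y_t = D y_zz + p y`,
`y(t,1) = 0` becomes `x_t = D x_zz - c x`, `x(t,1) = 0`, while
`x(t,0) = y(t,0) + ∫_0^1 k(0,s) y(t,s) ds` vanishes under the nominal feedback. -/
def IsBacksteppingKernel (D p c : ℝ) (k : ℝ → ℝ → ℝ) : Prop :=
  IsC2Kernel k ∧
    ∀ y : ℝ → ℝ, ContDiffOn ℝ 2 y (Icc 0 1) → y 1 = 0 → ∀ z ∈ Ioo (0 : ℝ) 1,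
      D * deriv (deriv (volterra k y)) z - c * volterra k y z
        = volterra k (fun s => D * deriv (deriv y) s + p * y s) z

/-- `l` is a kernel of the inverse of the Volterra transformation with kernel `k`. -/
def IsInverseKernel (k l : ℝ → ℝ → ℝ) : Prop :=
  IsC2Kernel l ∧
    ∀ x y : ℝ → ℝ, ContinuousOn x (Icc 0 1) → ContinuousOn y (Icc 0 1) →
      ((∀ z ∈ Icc (0 : ℝ) 1, x z = volterra k y z) ↔
        (∀ z ∈ Icc (0 : ℝ) 1, y z = volterra l x z))

/-- The norm of `L²(0,1)`. -/
noncomputable def l2norm (f : ℝ → ℝ) : ℝ := √(∫ z in (0 : ℝ)..1, f z ^ 2)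

/-- The `L²` norm of a kernel on the triangle `0 ≤ z ≤ s ≤ 1`. -/
noncomputable def kernelNorm (κ : ℝ → ℝ → ℝ) : ℝ :=
  √(∫ z in (0 : ℝ)..1, ∫ s in z..1, κ z s ^ 2)

/-- The boundary gain `G`, as a series over `n = 1, 2, …` with `ζ = √(c/D)`. -/
noncomputable def gain (D c : ℝ) : ℝ :=
  √2 / π * √(∑' n : ℕ, ((n : ℝ) + 1) ^ 2 / (√(c / D) ^ 2 / π ^ 2 + ((n : ℝ) + 1) ^ 2) ^ 2)

/-- `y` is a (global, classical) solution of `y_t = D y_zz + p y` on `(0,∞) × (0,1)` with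
`y(t,0) = d(t) - ∫_0^1 k(0,s) y(t,s) ds`, `y(t,1) = 0` for `t ≥ 0` and `y[0] = y₀`. -/
structure IsClosedLoopSolution (D p : ℝ) (k : ℝ → ℝ → ℝ) (d y₀ : ℝ → ℝ) (y : ℝ → ℝ → ℝ) :
    Prop where
  continuousOn : ContinuousOn (fun q : ℝ × ℝ => y q.1 q.2) (Ici 0 ×ˢ Icc 0 1)
  contDiffOn : ContDiffOn ℝ 1 (fun q : ℝ × ℝ => y q.1 q.2) (Ioi 0 ×ˢ Icc 0 1)
  profile : ∀ t, 0 ≤ t → ContDiffOn ℝ 2 (y t) (Icc 0 1)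
  pde : ∀ t, 0 < t → ∀ z ∈ Ioo (0 : ℝ) 1,
    deriv (fun τ => y τ z) t = D * deriv (deriv (y t)) z + p * y t z
  left : ∀ t, 0 ≤ t → y t 0 = d t - ∫ s in (0 : ℝ)..1, k 0 s * y t s
  right : ∀ t, 0 ≤ t → y t 1 = 0
  initial : ∀ z ∈ Icc (0 : ℝ) 1, y 0 z = y₀ z

end BoundaryISS

/-! The transformation x = T_k y turns the closed loop into x_t = D x_zz - c x with x(t,0) = d(t),
x(t,1) = 0: the feedback integral is exactly the integral part of T_k at z = 0. As T_l inverts T_k,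
one works with x and carries the result back at the price of the factors 1 + ‖l‖ and 1 + ‖k‖.

Estimate and uniqueness. Testing against sin(freq n · z), freq n = (n+1)π, and integrating by parts
twice gives a_n' = -λ_n a_n + D freq_n d with λ_n = c + D freq_n²
(`IsClosedLoopSolution.hasDerivAt_sineCoeff`). Hence |a_n(t)| ≤ e^(-λ_n t)|a_n(0)| + (D freq_n /
λ_n) max|d|. Young's inequality with weight ε, Parseval, and Σ 2 (D freq_n / λ_n)² = G² give the
bound for x; the difference of two solutions has d = 0 and zero initial value, so all its
coefficients vanish.

Gain. The numbers D freq_n / λ_n are the sine coefficients of the steady state W with D W'' = c W,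
W(0) = 1, W(1) = 0. So G = ‖W‖ (`gain_eq`), and W is explicit.

Kernels. With lam = (p+c)/D, the kernel lam (1-s) I₁(√w)/√w, w = lam((1-z)² - (1-s)²), is a
backstepping kernel, and its inverse is the same kernel for -lam. The latter reduces to a
convolution identity for w ↦ I₁(√w)/√w (`bessel_convolution`).

Existence. `exists_heatSolution` builds x as a sine series after removing the boundary datum to
second order; then y = T_l x solves the closed loop. -/

namespace BoundaryISS

open MeasureTheory Filter Topology intervalIntegral

/-! ### Extension of functions from intervals and squares -/

/-- The retraction of the real line onto `[0,1]`. -/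
noncomputable def clamp (x : ℝ) : ℝ := max 0 (min 1 x)

lemma continuous_clamp : Continuous clamp := by unfold clamp; fun_prop

lemma clamp_mem (x : ℝ) : clamp x ∈ Icc (0 : ℝ) 1 :=
  ⟨le_max_left _ _, max_le zero_le_one (min_le_left _ _)⟩

lemma clamp_of_mem {x : ℝ} (hx : x ∈ Icc (0 : ℝ) 1) : clamp x = x := by
  rw [clamp, min_eq_right hx.2, max_eq_right hx.1]

/-- Integrals with a moving lower end depend continuously on parameters. -/
lemma continuous_integral_lower {X : Type*} [TopologicalSpace X] [FirstCountableTopology X]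
    {f : X → ℝ → ℝ} (hf : Continuous (Function.uncurry f)) {a : X → ℝ} (ha : Continuous a)
    (b : ℝ) : Continuous fun x => ∫ s in a x..b, f x s := by
  have h : (fun x => ∫ s in a x..b, f x s) = fun x => -∫ s in b..a x, f x s := by
    funext x; rw [intervalIntegral.integral_symm]
  rw [h]
  exact (continuous_parametric_intervalIntegral_of_continuous hf ha).neg

lemma continuous_integral_interval {G : ℝ → ℝ → ℝ} (hG : Continuous (Function.uncurry G)) :
    Continuous (Function.uncurry fun a s => ∫ r in a..s, G r s) := by
  have hp := continuous_parametric_primitive_of_continuous (a₀ := (0 : ℝ)) (μ := volume)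
    (f := fun s r => G r s) (hG.comp (by fun_prop : Continuous fun p : ℝ × ℝ => (p.2, p.1)))
  have hslice : ∀ s, Continuous fun r => G r s := fun s => by fun_prop
  have h : (Function.uncurry fun a s => ∫ r in a..s, G r s) =
      fun q : ℝ × ℝ => (∫ r in (0 : ℝ)..q.2, G r q.2) - ∫ r in (0 : ℝ)..q.1, G r q.2 := by
    funext q
    exact (integral_interval_sub_left ((hslice _).intervalIntegrable _ _)
      ((hslice _).intervalIntegrable _ _)).symm
  rw [h]
  exact (hp.comp (by fun_prop : Continuous fun q : ℝ × ℝ => (q.2, q.2))).sub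
    (hp.comp (by fun_prop : Continuous fun q : ℝ × ℝ => (q.2, q.1)))

/-- Extension of functions of class `C¹` in the first variable. -/
lemma exists_primitive_extension {S : Set ℝ} (hS : S.OrdConnected) (h0 : (0 : ℝ) ∈ S)
    {X : Type*} [TopologicalSpace X] [FirstCountableTopology X]
    {f f' : ℝ → X → ℝ} (hf : ∀ s, ∀ z ∈ S, HasDerivWithinAt (fun z => f z s) (f' z s) S z)
    (hf0 : Continuous (f 0)) {F' : ℝ → X → ℝ} (hF' : Continuous (Function.uncurry F'))
    (hFf : ∀ s, ∀ z ∈ S, F' z s = f' z s) :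
    ∃ F : ℝ → X → ℝ, Continuous (Function.uncurry F) ∧
      (∀ s z, HasDerivAt (fun z => F z s) (F' z s) z) ∧ ∀ s, ∀ z ∈ S, F z s = f z s := by
  have hslice : ∀ s, Continuous fun z => F' z s := fun s => by fun_prop
  -- Only the derivative is extended by hand; integrating it from 0 recovers f on S and is
  -- differentiable everywhere.
  refine ⟨fun z s => f 0 s + ∫ r in (0 : ℝ)..z, F' r s, ?_, ?_, ?_⟩
  · have : Continuous fun q : ℝ × X => ∫ r in (0 : ℝ)..q.1, (fun (x : ℝ × X) r => F' r x.2) q r :=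
      continuous_parametric_intervalIntegral_of_continuous (by
        exact hF'.comp (by fun_prop : Continuous fun p : (ℝ × X) × ℝ => (p.2, p.1.2)))
        continuous_fst
    exact (hf0.comp continuous_snd).add this
  · intro s z
    exact (integral_hasDerivAt_right ((hslice s).intervalIntegrable _ _)
      ((hslice s).stronglyMeasurableAtFilter _ _) (hslice s).continuousAt).const_add _
  · intro s z hz
    have hsub : uIcc 0 z ⊆ S := hS.uIcc_subset h0 hz
    have hc : ContinuousOn (fun z => f z s) (uIcc 0 z) := fun w hw =>
      ((hf s w (hsub hw)).continuousWithinAt).mono hsub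
    have key : ∫ r in (0 : ℝ)..z, F' r s = f z s - f 0 s := by
      refine integral_eq_sub_of_hasDeriv_right hc ?_ ((hslice s).intervalIntegrable _ _)
      intro w hw
      have hw' : uIcc 0 z ∈ 𝓝 w := by
        rw [uIcc]; exact Icc_mem_nhds hw.1 hw.2
      have hwS : w ∈ S := hsub (Ioo_subset_Icc_self hw)
      have := (hf s w hwS).hasDerivAt (Filter.mem_of_superset hw' hsub)
      rw [hFf s w hwS]
      exact this.hasDerivWithinAt
    simp only [key]; ring

/-- A kernel of class `C²` on the square extends to the plane, with two continuous derivatives in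
the first variable. -/
lemma IsC2Kernel.exists_extension {κ : ℝ → ℝ → ℝ} (hκ : IsC2Kernel κ) :
    ∃ K K1 K2 : ℝ → ℝ → ℝ, Continuous (Function.uncurry K) ∧ Continuous (Function.uncurry K1) ∧
      Continuous (Function.uncurry K2) ∧ (∀ s z, HasDerivAt (fun z => K z s) (K1 z s) z) ∧
      (∀ s z, HasDerivAt (fun z => K1 z s) (K2 z s) z) ∧
      ∀ z ∈ Icc (0 : ℝ) 1, ∀ s ∈ Icc (0 : ℝ) 1, K z s = κ z s := by
  set Q : Set (ℝ × ℝ) := Icc 0 1 ×ˢ Icc 0 1 with hQ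
  have hu : UniqueDiffOn ℝ Q := (uniqueDiffOn_Icc zero_lt_one).prod (uniqueDiffOn_Icc zero_lt_one)
  -- derivative of a function on the square in the first direction
  have slice : ∀ φ : ℝ × ℝ → ℝ, ContDiffOn ℝ 1 φ Q → ∀ s ∈ Icc (0 : ℝ) 1, ∀ z ∈ Icc (0 : ℝ) 1,
      HasDerivWithinAt (fun z => φ (z, s)) (fderivWithin ℝ φ Q (z, s) (1, 0)) (Icc 0 1) z := by
    intro φ hφ s hs z hz
    have h1 := (hφ.differentiableOn (by norm_num) (z, s) ⟨hz, hs⟩).hasFDerivWithinAt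
    have h2 : HasDerivWithinAt (fun z : ℝ => (z, s)) ((1 : ℝ), (0 : ℝ)) (Icc 0 1) z :=
      ((hasDerivAt_id z).prodMk (hasDerivAt_const z s)).hasDerivWithinAt
    have hm : MapsTo (fun z : ℝ => (z, s)) (Icc 0 1) Q := fun w hw => ⟨hw, hs⟩
    exact h1.comp_hasDerivWithinAt z h2 hm
  set φ : ℝ × ℝ → ℝ := fun q => κ q.1 q.2 with hφdef
  have hφ : ContDiffOn ℝ 2 φ Q := hκ
  set φ1 : ℝ × ℝ → ℝ := fun q => fderivWithin ℝ φ Q q (1, 0) with hφ1def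
  have hφ1 : ContDiffOn ℝ 1 φ1 Q :=
    (hφ.fderivWithin hu (by norm_num : (1 : WithTop ℕ∞) + 1 ≤ 2)).clm_apply contDiffOn_const
  set φ2 : ℝ × ℝ → ℝ := fun q => fderivWithin ℝ φ1 Q q (1, 0) with hφ2def
  have hφ2 : ContDiffOn ℝ 0 φ2 Q :=
    (hφ1.fderivWithin hu (by norm_num : (0 : WithTop ℕ∞) + 1 ≤ 1)).clm_apply contDiffOn_const
  have hcl : ∀ φ : ℝ × ℝ → ℝ, ContinuousOn φ Q →
      Continuous fun q : ℝ × ℝ => φ (clamp q.1, clamp q.2) := fun φ h =>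
    h.comp_continuous ((continuous_clamp.comp continuous_fst).prodMk
      (continuous_clamp.comp continuous_snd)) fun q => ⟨clamp_mem _, clamp_mem _⟩
  have h01 : (0 : ℝ) ∈ Icc (0 : ℝ) 1 := ⟨le_rfl, zero_le_one⟩
  have hc0 : ∀ φ : ℝ × ℝ → ℝ, ContinuousOn φ Q → Continuous fun s : ℝ => φ (0, clamp s) :=
    fun φ h => h.comp_continuous (continuous_const.prodMk continuous_clamp)
      fun q => ⟨h01, clamp_mem _⟩
  -- The second z-derivative is extended by clamping and then integrated twice in z. The extension
  -- is thus C² in z, but only continuous in s.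
  obtain ⟨K1, hK1, hK1d, hK1e⟩ := exists_primitive_extension (S := Icc (0 : ℝ) 1)
    ordConnected_Icc h01
    (f := fun z s => φ1 (z, clamp s)) (f' := fun z s => φ2 (z, clamp s))
    (fun s z hz => slice φ1 hφ1 _ (clamp_mem s) z hz) (hc0 _ hφ1.continuousOn)
    (F' := fun z s => φ2 (clamp z, clamp s)) (hcl _ hφ2.continuousOn)
    (fun s z hz => by simp only [clamp_of_mem hz])
  obtain ⟨K, hK, hKd, hKe⟩ := exists_primitive_extension (S := Icc (0 : ℝ) 1)
    ordConnected_Icc h01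
    (f := fun z s => φ (z, clamp s)) (f' := fun z s => φ1 (z, clamp s))
    (fun s z hz => slice φ (hφ.of_le (by norm_num)) _ (clamp_mem s) z hz)
    (hc0 _ hφ.continuousOn) hK1 hK1e
  refine ⟨K, K1, fun z s => φ2 (clamp z, clamp s), hK, hK1, hcl _ hφ2.continuousOn, hKd, hK1d, fun z hz s hs => ?_⟩
  rw [hKe s z hz, clamp_of_mem hs]

/-- `C²` data of a function on the line. -/
structure IsC2Data (f f1 f2 : ℝ → ℝ) : Prop where
  d1 : ∀ z, HasDerivAt f (f1 z) z
  d2 : ∀ z, HasDerivAt f1 (f2 z) z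
  cont2 : Continuous f2

lemma IsC2Data.cont {f f1 f2 : ℝ → ℝ} (h : IsC2Data f f1 f2) : Continuous f :=
  continuous_iff_continuousAt.2 fun z => (h.d1 z).continuousAt

lemma IsC2Data.cont1 {f f1 f2 : ℝ → ℝ} (h : IsC2Data f f1 f2) : Continuous f1 :=
  continuous_iff_continuousAt.2 fun z => (h.d2 z).continuousAt

lemma IsC2Data.contDiff {f f1 f2 : ℝ → ℝ} (h : IsC2Data f f1 f2) : ContDiff ℝ 2 f := by
  have e1 : deriv f = f1 := funext fun z => (h.d1 z).deriv
  have e2 : deriv f1 = f2 := funext fun z => (h.d2 z).deriv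
  rw [show (2 : WithTop ℕ∞) = 1 + 1 by norm_num, contDiff_succ_iff_deriv]
  refine ⟨fun z => (h.d1 z).differentiableAt, by simp, ?_⟩
  rw [e1, contDiff_one_iff_deriv, e2]
  exact ⟨fun z => (h.d2 z).differentiableAt, h.cont2⟩

lemma IsC2Data.deriv2 {f f1 f2 : ℝ → ℝ} (h : IsC2Data f f1 f2) {y : ℝ → ℝ} {U : Set ℝ}
    (hU : IsOpen U) (hy : EqOn y f U) {z : ℝ} (hz : z ∈ U) : deriv (deriv y) z = f2 z := by
  have e1 : ∀ w ∈ U, deriv y w = f1 w := fun w hw => by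
    rw [(Filter.eventuallyEq_of_mem (hU.mem_nhds hw) hy).deriv_eq, (h.d1 w).deriv]
  rw [(Filter.eventuallyEq_of_mem (hU.mem_nhds hz) e1).deriv_eq, (h.d2 z).deriv]

/-- A function of class `C²` on a closed interval extends to the line. -/
lemma exists_C2Data {S : Set ℝ} (hS : S.OrdConnected) (hu : UniqueDiffOn ℝ S)
    (h0 : (0 : ℝ) ∈ S) {ρ : ℝ → ℝ} (hρ : Continuous ρ) (hρS : ∀ x, ρ x ∈ S)
    (hρid : ∀ x ∈ S, ρ x = x) {y : ℝ → ℝ} (hy : ContDiffOn ℝ 2 y S) :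
    ∃ f f1 f2, IsC2Data f f1 f2 ∧ EqOn f y S := by
  set y1 := derivWithin y S
  set y2 := derivWithin y1 S
  have hy1 : ContDiffOn ℝ 1 y1 S := hy.derivWithin hu (by norm_num)
  have hy2 : ContDiffOn ℝ 0 y2 S := hy1.derivWithin hu (by norm_num)
  obtain ⟨f1, hf1, hf1d, hf1e⟩ := exists_primitive_extension hS h0 (X := Unit)
    (f := fun z _ => y1 z) (f' := fun z _ => y2 z)
    (fun _ z hz => (hy1.differentiableOn (by norm_num) z hz).hasDerivWithinAt)
    continuous_const (F' := fun z _ => y2 (ρ z))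
    ((hy2.continuousOn.comp_continuous hρ hρS).comp continuous_fst)
    (fun _ z hz => by simp only [hρid z hz])
  obtain ⟨f, hf, hfd, hfe⟩ := exists_primitive_extension hS h0 (X := Unit)
    (f := fun z _ => y z) (f' := fun z _ => y1 z)
    (fun _ z hz => (hy.differentiableOn (by norm_num) z hz).hasDerivWithinAt)
    continuous_const hf1 hf1e
  exact ⟨fun z => f z (), fun z => f1 z (), fun z => y2 (ρ z),
    ⟨fun z => hfd () z, fun z => hf1d () z, hy2.continuousOn.comp_continuous hρ hρS⟩,
    fun z hz => hfe () z hz⟩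

lemma exists_C2Data_Icc {y : ℝ → ℝ} (hy : ContDiffOn ℝ 2 y (Icc 0 1)) :
    ∃ f f1 f2, IsC2Data f f1 f2 ∧ EqOn f y (Icc 0 1) :=
  exists_C2Data ordConnected_Icc (uniqueDiffOn_Icc zero_lt_one) ⟨le_rfl, zero_le_one⟩
    continuous_clamp clamp_mem (fun _ => clamp_of_mem) hy

lemma exists_C2Data_Ici {y : ℝ → ℝ} (hy : ContDiffOn ℝ 2 y (Ici 0)) :
    ∃ f f1 f2, IsC2Data f f1 f2 ∧ EqOn f y (Ici 0) :=
  exists_C2Data ordConnected_Ici (uniqueDiffOn_Ici 0) self_mem_Ici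
    (continuous_const.max continuous_id) (fun _ => mem_Ici.2 (le_max_left _ _))
    (fun _ hx => max_eq_right hx) hy

/-! ### Differentiation and continuity of parametric integrals -/

/-- The Leibniz rule for a moving lower end. -/
lemma hasDerivAt_integral_lower {g g1 : ℝ → ℝ → ℝ} (hg : Continuous (Function.uncurry g))
    (hg1 : Continuous (Function.uncurry g1))
    (hd : ∀ s z, HasDerivAt (fun z => g z s) (g1 z s) z) (b z : ℝ) :
    HasDerivAt (fun z => ∫ s in z..b, g z s) (-g z z + ∫ s in z..b, g1 z s) z := by
  have hslice : ∀ z, Continuous (g z) := fun z => by fun_prop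
  have hslice1 : ∀ z, Continuous (g1 z) := fun z => by fun_prop
  -- Separate the two roles of z: u is the lower end, v the parameter. Both partial derivatives of H
  -- are continuous, so H is differentiable and can be restricted to the diagonal u = v = z.
  set H : ℝ → ℝ → ℝ := fun u v => ∫ s in u..b, g v s
  have d1 : ∀ u v, HasDerivAt (fun u => H u v) (-g v u) u := fun u v =>
    integral_hasDerivAt_left ((hslice v).intervalIntegrable _ _)
      ((hslice v).stronglyMeasurableAtFilter _ _) (hslice v).continuousAt
  have d2 : ∀ u v, HasDerivAt (fun v => H u v) (∫ s in u..b, g1 v s) v := by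
    intro u v
    obtain ⟨M, hM⟩ := ((isCompact_Icc (a := v - 1) (b := v + 1)).prod
      (isCompact_uIcc (a := u) (b := b))).exists_bound_of_continuousOn hg1.continuousOn
    refine (intervalIntegral.hasDerivAt_integral_of_dominated_loc_of_deriv_le (bound := fun _ => M)
      (Icc_mem_nhds (a := v - 1) (b := v + 1) (by linarith) (by linarith)) ?_ ?_ ?_ ?_ ?_ ?_).2
    · exact Eventually.of_forall fun x => (hslice x).aestronglyMeasurable
    · exact (hslice v).intervalIntegrable _ _
    · exact (hslice1 v).aestronglyMeasurable
    · exact Eventually.of_forall fun t ht x hx => hM (x, t) ⟨hx, uIoc_subset_uIcc ht⟩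
    · exact intervalIntegrable_const
    · exact Eventually.of_forall fun t _ x _ => hd t x
  have c2 : Continuous fun q : ℝ × ℝ => ∫ s in q.1..b, g1 q.2 s :=
    continuous_integral_lower (f := fun (q : ℝ × ℝ) s => g1 q.2 s)
      (hg1.comp (by fun_prop : Continuous fun p : (ℝ × ℝ) × ℝ => (p.1.2, p.2))) continuous_fst b
  have c1 : Continuous fun q : ℝ × ℝ => -g q.2 q.1 :=
    (hg.comp (by fun_prop : Continuous fun p : ℝ × ℝ => (p.2, p.1))).neg
  have key := hasStrictFDerivAt_uncurry_coprod (𝕜 := ℝ) (u := (z, z)) (f := H)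
    (f₁ := fun u v => ContinuousLinearMap.toSpanSingleton ℝ (-g v u))
    (f₂ := fun u v => ContinuousLinearMap.toSpanSingleton ℝ (∫ s in u..b, g1 v s))
    (Eventually.of_forall fun q => (d1 q.1 q.2).hasFDerivAt)
    (Eventually.of_forall fun q => (d2 q.1 q.2).hasFDerivAt)
    ((ContinuousLinearMap.toSpanSingletonCLE (𝕜 := ℝ) (E := ℝ)).continuous.comp c1).continuousAt
    ((ContinuousLinearMap.toSpanSingletonCLE (𝕜 := ℝ) (E := ℝ)).continuous.comp c2).continuousAt
  have hdiag : HasDerivAt (fun z : ℝ => (z, z)) ((1 : ℝ), (1 : ℝ)) z :=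
    (hasDerivAt_id z).prodMk (hasDerivAt_id z)
  have := key.hasFDerivAt.comp_hasDerivAt (f := fun z : ℝ => (z, z)) z hdiag
  simpa [Function.HasUncurry.uncurry, H, Function.comp_def] using this

/-- Differentiation of a parametric integral over a fixed interval. -/
lemma hasDerivAt_integral_param {f f' : ℝ → ℝ → ℝ} {a b : ℝ} {U : Set ℝ} (hU : IsOpen U)
    (hf : ∀ t ∈ U, ContinuousOn (f t) (uIcc a b))
    (hf' : ContinuousOn (Function.uncurry f') (U ×ˢ uIcc a b))
    (hd : ∀ t ∈ U, ∀ s ∈ uIcc a b, HasDerivAt (fun t => f t s) (f' t s) t) {t : ℝ} (ht : t ∈ U) :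
    HasDerivAt (fun t => ∫ s in a..b, f t s) (∫ s in a..b, f' t s) t := by
  obtain ⟨δ, hδ, hball⟩ := Metric.nhds_basis_closedBall.mem_iff.1 (hU.mem_nhds ht)
  obtain ⟨M, hM⟩ := ((isCompact_closedBall t δ).prod
    (isCompact_uIcc (a := a) (b := b))).exists_bound_of_continuousOn
    (hf'.mono (prod_mono hball Subset.rfl))
  refine (intervalIntegral.hasDerivAt_integral_of_dominated_loc_of_deriv_le (bound := fun _ => M)
    (Metric.closedBall_mem_nhds t hδ) ?_ ?_ ?_ ?_ ?_ ?_).2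
  · filter_upwards [hU.mem_nhds ht] with x hx
    exact ((hf x hx).mono uIoc_subset_uIcc).aestronglyMeasurable measurableSet_uIoc
  · exact (hf t ht).intervalIntegrable
  · have : ContinuousOn (f' t) (uIcc a b) :=
      hf'.comp (f := fun s => (t, s)) (by fun_prop) fun s hs => ⟨ht, hs⟩
    exact (this.mono uIoc_subset_uIcc).aestronglyMeasurable measurableSet_uIoc
  · exact Eventually.of_forall fun s hs x hx => hM (x, s) ⟨hx, uIoc_subset_uIcc hs⟩
  · exact intervalIntegrable_const
  · exact Eventually.of_forall fun s hs x hx => hd x (hball hx) s (uIoc_subset_uIcc hs)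

lemma continuousOn_integral_kernel {S : Set ℝ} {F : ℝ → ℝ → ℝ}
    (hF : ContinuousOn (Function.uncurry F) (S ×ˢ univ)) {L : ℝ → ℝ → ℝ}
    (hL : Continuous (Function.uncurry L)) :
    ContinuousOn (fun q : ℝ × ℝ => ∫ s in q.2..1, L q.2 s * F q.1 s) (S ×ˢ univ) := by
  rw [continuousOn_iff_continuous_domRestrict]
  refine continuous_integral_lower
    (f := fun (q : ↥(S ×ˢ (univ : Set ℝ))) s => L q.1.2 s * F q.1.1 s) ?_ (by fun_prop) 1
  refine Continuous.mul ?_ ?_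
  · exact hL.comp (by fun_prop : Continuous fun p : ↥(S ×ˢ (univ : Set ℝ)) × ℝ => (p.1.1.2, p.2))
  · exact hF.comp_continuous
      (by fun_prop : Continuous fun p : ↥(S ×ˢ (univ : Set ℝ)) × ℝ => (p.1.1.1, p.2))
      fun p => ⟨p.1.2.1, mem_univ _⟩

lemma continuousOn_integral_param {S : Set ℝ} {F : ℝ → ℝ → ℝ}
    (hF : ContinuousOn (Function.uncurry F) (S ×ˢ univ)) (a b : ℝ) :
    ContinuousOn (fun t => ∫ s in a..b, F t s) S := by
  rw [continuousOn_iff_continuous_domRestrict]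
  refine continuous_parametric_intervalIntegral_of_continuous' (f := fun (q : ↥S) s => F q.1 s)
    ?_ a b
  exact hF.comp_continuous (by fun_prop : Continuous fun p : ↥S × ℝ => (p.1.1, p.2))
      fun p => ⟨p.1.2, mem_univ _⟩

/-! ### Sine series on the unit interval -/

/-- The Dirichlet frequencies of the unit interval. -/
noncomputable def freq (n : ℕ) : ℝ := ((n : ℝ) + 1) * π

lemma freq_pos (n : ℕ) : 0 < freq n := by unfold freq; positivity

lemma pi_le_freq (n : ℕ) : π ≤ freq n := by
  have : (0 : ℝ) ≤ n := n.cast_nonneg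
  unfold freq; nlinarith [pi_pos]

lemma one_le_freq (n : ℕ) : 1 ≤ freq n := by
  linarith [pi_le_freq n, pi_gt_three]

lemma sin_freq (n : ℕ) : sin (freq n) = 0 := by
  have := sin_nat_mul_pi (n + 1)
  push_cast at this; exact this

lemma cos_freq (n : ℕ) : cos (freq n) = (-1) ^ (n + 1) := by
  have := cos_nat_mul_pi (n + 1)
  push_cast at this; exact this

/-- The sine coefficients of a function on the unit interval. -/
noncomputable def sineCoeff (f : ℝ → ℝ) (n : ℕ) : ℝ := ∫ z in (0 : ℝ)..1, f z * sin (freq n * z)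

lemma sineCoeff_congr {f g : ℝ → ℝ} (h : EqOn f g (Icc 0 1)) (n : ℕ) :
    sineCoeff f n = sineCoeff g n := by
  refine integral_congr fun z hz => ?_
  rw [uIcc_of_le zero_le_one] at hz
  simp only [h hz]

/-- Two integrations by parts: the boundary terms with sine vanish, those with cosine leave the
boundary values of W. This is how a boundary input enters each mode. -/
lemma IsC2Data.sineCoeff_deriv2 {W W1 W2 : ℝ → ℝ} (h : IsC2Data W W1 W2) (n : ℕ) :
    sineCoeff W2 n = freq n * (W 0 - (-1) ^ (n + 1) * W 1) - freq n ^ 2 * sineCoeff W n := by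
  have hd : ∀ z, HasDerivAt (fun z => W1 z * sin (freq n * z) - freq n * (W z * cos (freq n * z)))
      (W2 z * sin (freq n * z) + freq n ^ 2 * (W z * sin (freq n * z))) z := by
    intro z
    have h1 : HasDerivAt (fun z => freq n * z) (freq n) z := by
      simpa using (hasDerivAt_id z).const_mul (freq n)
    have := ((h.d2 z).mul h1.sin).sub (((h.d1 z).mul h1.cos).const_mul (freq n))
    refine this.congr_deriv ?_
    ring
  have c0 := h.cont
  have c2 := h.cont2
  have key := integral_eq_sub_of_hasDerivAt (a := 0) (b := 1) (fun z _ => hd z)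
    (Continuous.intervalIntegrable (by fun_prop) _ _)
  rw [intervalIntegral.integral_add (Continuous.intervalIntegrable (by fun_prop) _ _)
    (Continuous.intervalIntegrable (by fun_prop) _ _), intervalIntegral.integral_const_mul] at key
  simp only [mul_one, mul_zero, sin_freq, cos_freq, sin_zero, cos_zero] at key
  unfold sineCoeff
  linear_combination key

/-- Parseval's identity for sine series of globally continuous functions. -/
lemma hasSum_sq_sineCoeff_of_continuous {f : ℝ → ℝ} (hf : Continuous f) :
    HasSum (fun n => 2 * sineCoeff f n ^ 2) (∫ z in (0 : ℝ)..1, f z ^ 2) := by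
  -- Odd extension to (-1,1], whose Fourier coefficients are multiples of sine integrals. It may
  -- jump at 0 and at the ends, which is harmless in L².
  set F : ℝ → ℂ := fun x => if 0 < x then (f x : ℂ) else -(f (-x) : ℂ) with hF
  have hmeas : Measurable F := Measurable.ite measurableSet_Ioi (by fun_prop) (by fun_prop)
  have hpos : ∀ x ∈ Ioc (0 : ℝ) 1, F x = f x := fun x hx => by simp [hF, hx.1]
  have hneg : ∀ x ∈ Ioc (0 : ℝ) 1, F (-x) = -f x := fun x hx => by
    simp [hF, not_lt.2 hx.1.le]
  obtain ⟨M, hM⟩ := (isCompact_Icc (a := (-1 : ℝ)) (b := 1)).exists_bound_of_continuousOn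
    hf.continuousOn
  have hbd : ∀ x ∈ Ioc (-1 : ℝ) 1, ‖F x‖ ≤ M := by
    intro x hx
    simp only [hF]
    split_ifs with h0
    · simpa using hM x ⟨hx.1.le, hx.2⟩
    · simpa using hM (-x) ⟨by linarith [hx.2], by linarith [hx.1]⟩
  have hL2 : MemLp F 2 (volume.restrict (Ioc (-1 : ℝ) 1)) :=
    MemLp.of_bound hmeas.aestronglyMeasurable M
      ((ae_restrict_iff' measurableSet_Ioc).2 (Eventually.of_forall hbd))
  have hint : ∀ a b, -1 ≤ a → a ≤ b → b ≤ 1 → ∀ φ : ℝ → ℂ, Continuous φ →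
      IntervalIntegrable (fun x => φ x * F x) volume a b := by
    intro a b ha hab hb φ hφ
    have h1 : IntegrableOn F (Ioc a b) :=
      IntegrableOn.mono_set (hL2.integrable (by norm_num)) (Ioc_subset_Ioc ha hb)
    exact ((intervalIntegrable_iff_integrableOn_Ioc_of_le hab).2 h1).continuousOn_mul
      hφ.continuousOn
  have P := hasSum_sq_fourierCoeffOn (by norm_num : (-1 : ℝ) < 1) hL2
  -- folding an integral over `[-1,1]`
  have fold : ∀ G : ℝ → ℂ, IntervalIntegrable G volume (-1) 0 → IntervalIntegrable G volume 0 1 →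
      ∫ x in (-1 : ℝ)..1, G x = (∫ x in (0 : ℝ)..1, G (-x)) + ∫ x in (0 : ℝ)..1, G x := by
    intro G h1 h2
    rw [intervalIntegral.integral_comp_neg]
    simp only [neg_zero]
    exact (integral_add_adjacent_intervals h1 h2).symm
  have hcoef : ∀ n : ℤ, fourierCoeffOn (by norm_num : (-1 : ℝ) < 1) F n =
      -Complex.I * ((∫ x in (0 : ℝ)..1, f x * sin (n * π * x) : ℝ) : ℂ) := by
    intro n
    set e : ℝ → ℂ := fun x => Complex.exp (-(n * π * x : ℝ) * Complex.I) with he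
    have hec : Continuous e := by fun_prop
    have hfe : ∀ x : ℝ, (fourier (-n) (x : AddCircle ((1 : ℝ) - -1)) : ℂ) = e x := by
      intro x
      rw [fourier_coe_apply, he]
      congr 1
      push_cast
      ring
    rw [fourierCoeffOn_eq_integral]
    simp only [hfe, smul_eq_mul]
    rw [fold _ (hint _ _ le_rfl (by norm_num) (by norm_num) e hec)
      (hint _ _ (by norm_num) (by norm_num) le_rfl e hec)]
    have i1 : ∫ x in (0 : ℝ)..1, e (-x) * F (-x) = ∫ x in (0 : ℝ)..1, e (-x) * (-f x) := by
      refine integral_congr_ae (Eventually.of_forall fun x hx => ?_)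
      rw [uIoc_of_le zero_le_one] at hx
      simp only [hneg x hx]
    have i2 : ∫ x in (0 : ℝ)..1, e x * F x = ∫ x in (0 : ℝ)..1, e x * f x := by
      refine integral_congr_ae (Eventually.of_forall fun x hx => ?_)
      rw [uIoc_of_le zero_le_one] at hx
      simp only [hpos x hx]
    rw [i1, i2, ← intervalIntegral.integral_add (Continuous.intervalIntegrable (by fun_prop) _ _)
      (Continuous.intervalIntegrable (by fun_prop) _ _), ← intervalIntegral.integral_ofReal,
      ← intervalIntegral.integral_const_mul, ← intervalIntegral.integral_smul]
    refine integral_congr fun x _ => ?_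
    have e1 : e x = Complex.cos (n * π * x : ℝ) - Complex.sin (n * π * x : ℝ) * Complex.I := by
      simp only [he]
      rw [Complex.exp_mul_I, Complex.cos_neg, Complex.sin_neg]; ring
    have e2 : e (-x) = Complex.cos (n * π * x : ℝ) + Complex.sin (n * π * x : ℝ) * Complex.I := by
      simp only [he]
      rw [show (n : ℝ) * π * -x = -(n * π * x) by ring, Complex.ofReal_neg, neg_neg,
        Complex.exp_mul_I]
    simp only [e1, e2, Complex.real_smul]
    push_cast
    ring
  have hnorm : ∀ n : ℤ, ‖fourierCoeffOn (by norm_num : (-1 : ℝ) < 1) F n‖ ^ 2 =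
      (∫ x in (0 : ℝ)..1, f x * sin (n * π * x)) ^ 2 := by
    intro n
    rw [hcoef, norm_mul, norm_neg, Complex.norm_I, one_mul, Complex.norm_real, norm_eq_abs, sq_abs]
  have hval : ((1 : ℝ) - -1)⁻¹ • ∫ x in (-1 : ℝ)..1, ‖F x‖ ^ 2 = ∫ z in (0 : ℝ)..1, f z ^ 2 := by
    have hsq : ∀ a b, -1 ≤ a → a ≤ b → b ≤ 1 → IntervalIntegrable (fun x => ‖F x‖ ^ 2) volume a b := by
      intro a b ha hab hb
      have h1 : IntegrableOn (fun x => ‖F x‖ ^ 2) (Ioc a b) :=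
        IntegrableOn.mono_set (hL2.integrable_norm_pow (by norm_num)) (Ioc_subset_Ioc ha hb)
      exact (intervalIntegrable_iff_integrableOn_Ioc_of_le hab).2 h1
    have i1 : ∫ x in (-1 : ℝ)..0, ‖F x‖ ^ 2 = ∫ x in (0 : ℝ)..1, f x ^ 2 := by
      have := intervalIntegral.integral_comp_neg (a := 0) (b := 1) (fun x => ‖F x‖ ^ 2)
      rw [neg_zero] at this
      rw [← this]
      refine integral_congr_ae (Eventually.of_forall fun x hx => ?_)
      rw [uIoc_of_le zero_le_one] at hx
      simp only [hneg x hx]; simp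
    have i2 : ∫ x in (0 : ℝ)..1, ‖F x‖ ^ 2 = ∫ x in (0 : ℝ)..1, f x ^ 2 := by
      refine integral_congr_ae (Eventually.of_forall fun x hx => ?_)
      rw [uIoc_of_le zero_le_one] at hx
      simp only [hpos x hx]; simp
    rw [← integral_add_adjacent_intervals (hsq (-1) 0 le_rfl (by norm_num) (by norm_num))
      (hsq 0 1 (by norm_num) (by norm_num) le_rfl), i1, i2, smul_eq_mul]
    ring
  rw [hval] at P
  simp only [hnorm] at P
  -- Folding the sum over ℤ pairs n with -n, which have equal squares; the index 0 contributes
  -- nothing since sin 0 = 0. Dropping it matches the numbering of `freq`, which starts at π.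
  have Q := P.nat_add_neg
  have Q1 := (hasSum_nat_add_iff' 1).2 Q
  simp only [Finset.sum_range_one] at Q1
  convert! Q1 using 1
  · funext n
    have h1 : ((((n + 1 : ℕ) : ℤ) : ℝ)) * π = freq n := by unfold freq; push_cast; ring
    have h2 : (((-((n + 1 : ℕ) : ℤ) : ℤ) : ℝ)) * π = -freq n := by unfold freq; push_cast; ring
    simp only [h1, h2, neg_mul, sin_neg, mul_neg, intervalIntegral.integral_neg, neg_sq]
    unfold sineCoeff; ring
  · simp

/-- Parseval's identity for sine series. -/
lemma hasSum_sq_sineCoeff {f : ℝ → ℝ} (hf : ContinuousOn f (Icc 0 1)) :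
    HasSum (fun n => 2 * sineCoeff f n ^ 2) (∫ z in (0 : ℝ)..1, f z ^ 2) := by
  have hg : Continuous fun z => f (clamp z) := hf.comp_continuous continuous_clamp clamp_mem
  have he : EqOn (fun z => f (clamp z)) f (Icc 0 1) := fun z hz => by simp only [clamp_of_mem hz]
  have := hasSum_sq_sineCoeff_of_continuous hg
  have hi : ∫ z in (0 : ℝ)..1, f (clamp z) ^ 2 = ∫ z in (0 : ℝ)..1, f z ^ 2 := by
    refine integral_congr fun z hz => ?_
    rw [uIcc_of_le zero_le_one] at hz
    simp only [clamp_of_mem hz]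
  simp only [sineCoeff_congr he, hi] at this
  exact this

lemma eqOn_zero_of_integral_sq {f : ℝ → ℝ} (hf : ContinuousOn f (Icc 0 1))
    (h : ∫ z in (0 : ℝ)..1, f z ^ 2 = 0) : ∀ z ∈ Icc (0 : ℝ) 1, f z = 0 := by
  by_contra! hne
  obtain ⟨z, hz, hfz⟩ := hne
  have : 0 < ∫ z in (0 : ℝ)..1, f z ^ 2 :=
    integral_pos zero_lt_one (hf.pow 2) (fun x _ => sq_nonneg _) ⟨z, hz, by positivity⟩
  linarith

/-- Completeness of the sine system. -/
lemma eqOn_of_sineCoeff_eq {f g : ℝ → ℝ} (hf : ContinuousOn f (Icc 0 1))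
    (hg : ContinuousOn g (Icc 0 1)) (h : ∀ n, sineCoeff f n = sineCoeff g n) :
    EqOn f g (Icc 0 1) := by
  have hs : ∀ n, sineCoeff (fun z => f z - g z) n = 0 := by
    intro n
    have hi : ∀ φ : ℝ → ℝ, ContinuousOn φ (Icc 0 1) →
        IntervalIntegrable (fun z => φ z * sin (freq n * z)) volume 0 1 := fun φ hφ =>
      ContinuousOn.intervalIntegrable (by
        rw [uIcc_of_le zero_le_one]
        exact hφ.mul (by fun_prop))
    have : sineCoeff (fun z => f z - g z) n = sineCoeff f n - sineCoeff g n := by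
      unfold sineCoeff
      rw [← intervalIntegral.integral_sub (hi f hf) (hi g hg)]
      simp only [sub_mul]
    rw [this, h, sub_self]
  have := hasSum_sq_sineCoeff (f := fun z => f z - g z) (hf.sub hg)
  have h0 : ∫ z in (0 : ℝ)..1, (f z - g z) ^ 2 = 0 := by
    refine this.unique ?_
    simp only [hs]
    simp
  intro z hz
  exact sub_eq_zero.1 (eqOn_zero_of_integral_sq (hf.sub hg) h0 z hz)

lemma isC2Data_sin (n : ℕ) : IsC2Data (fun z => sin (freq n * z))
    (fun z => freq n * cos (freq n * z)) (fun z => -freq n ^ 2 * sin (freq n * z)) := by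
  have h1 : ∀ z, HasDerivAt (fun z => freq n * z) (freq n) z := fun z => by
    simpa using (hasDerivAt_id z).const_mul (freq n)
  refine ⟨fun z => (h1 z).sin.congr_deriv (by ring), fun z => ?_, by fun_prop⟩
  exact ((h1 z).cos.const_mul (freq n)).congr_deriv (by ring)

lemma sineCoeff_const_mul (a : ℝ) (f : ℝ → ℝ) (n : ℕ) :
    sineCoeff (fun z => a * f z) n = a * sineCoeff f n := by
  unfold sineCoeff
  rw [← intervalIntegral.integral_const_mul]
  simp only [mul_assoc]

/-- Orthogonality comes from the eigenvalue relation: (freq n² - freq m²) times the coefficient is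
0. The value 1/2 needs no integration: for n = m the coefficient s equals ∫ sin², so Parseval says s
= 2s², and s > 0. -/
lemma sineCoeff_sin (m n : ℕ) :
    sineCoeff (fun z => sin (freq m * z)) n = if n = m then 1 / 2 else 0 := by
  have orth : ∀ n, n ≠ m → sineCoeff (fun z => sin (freq m * z)) n = 0 := by
    intro n hnm
    have h := (isC2Data_sin m).sineCoeff_deriv2 n
    rw [sineCoeff_const_mul] at h
    simp only [mul_zero, sin_zero, mul_one, sin_freq, sub_zero, zero_sub] at h
    have hne : freq n ^ 2 - freq m ^ 2 ≠ 0 := by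
      have h1 : freq n - freq m ≠ 0 := by
        unfold freq
        rw [← sub_mul]
        refine mul_ne_zero ?_ pi_ne_zero
        intro h
        apply hnm
        have : (n : ℝ) = m := by linarith
        exact_mod_cast this
      have h2 := freq_pos n
      have h3 := freq_pos m
      rw [sq_sub_sq]
      exact mul_ne_zero (by positivity) h1
    have : (freq n ^ 2 - freq m ^ 2) * sineCoeff (fun z => sin (freq m * z)) n = 0 := by
      linear_combination h
    exact (mul_eq_zero.1 this).resolve_left hne
  split_ifs with hnm
  · subst hnm
    have hP := hasSum_sq_sineCoeff_of_continuous (isC2Data_sin n).cont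
    have h1 : ∫ z in (0 : ℝ)..1, sin (freq n * z) ^ 2
        = sineCoeff (fun z => sin (freq n * z)) n := by
      unfold sineCoeff; simp only [sq]
    rw [h1] at hP
    have hu := hP.unique (hasSum_single n fun k hk => by rw [orth k hk]; ring)
    have hp : 0 < sineCoeff (fun z => sin (freq n * z)) n := by
      rw [← h1]
      have hc := (isC2Data_sin n).cont
      refine integral_pos zero_lt_one (by fun_prop) (fun x _ => sq_nonneg _)
        ⟨1 / (2 * ((n : ℝ) + 1)), ⟨by positivity, ?_⟩, ?_⟩
      · rw [div_le_one (by positivity)]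
        have : (0 : ℝ) ≤ n := n.cast_nonneg
        linarith
      · have : freq n * (1 / (2 * ((n : ℝ) + 1))) = π / 2 := by unfold freq; field_simp
        rw [this, sin_pi_div_two]; norm_num
    have : sineCoeff (fun z => sin (freq n * z)) n * (2 * sineCoeff (fun z => sin (freq n * z)) n - 1)
        = 0 := by linear_combination -hu
    have := (mul_eq_zero.1 this).resolve_left hp.ne'
    linarith
  · exact orth n hnm

/-- A continuous function with summable sine coefficients is the sum of its sine series. -/
lemma tsum_sineCoeff_eq {f : ℝ → ℝ} (hf : ContinuousOn f (Icc 0 1))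
    (hs : Summable fun n => |sineCoeff f n|) :
    ∀ z ∈ Icc (0 : ℝ) 1, ∑' n, 2 * sineCoeff f n * sin (freq n * z) = f z := by
  have hs2 : Summable fun n => 2 * |sineCoeff f n| := hs.mul_left 2
  have hbd : ∀ n z, ‖2 * sineCoeff f n * sin (freq n * z)‖ ≤ 2 * |sineCoeff f n| := by
    intro n z
    rw [norm_mul, norm_mul, norm_eq_abs, norm_eq_abs, norm_eq_abs, abs_two]
    exact mul_le_of_le_one_right (by positivity) (abs_sin_le_one _)
  have hc : Continuous fun z => ∑' n, 2 * sineCoeff f n * sin (freq n * z) :=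
    continuous_tsum (fun n => by fun_prop) hs2 hbd
  -- The series converges uniformly, hence to a continuous function; by completeness it suffices to
  -- compare coefficients, integrating term by term.
  refine eqOn_of_sineCoeff_eq hc.continuousOn hf fun m => ?_
  have key : HasSum (fun n => ∫ z in (0 : ℝ)..1, 2 * sineCoeff f n * sin (freq n * z) *
      sin (freq m * z)) (∫ z in (0 : ℝ)..1, (∑' n, 2 * sineCoeff f n * sin (freq n * z)) *
      sin (freq m * z)) := by
    refine hasSum_integral_of_dominated_convergence (fun n _ => 2 * |sineCoeff f n|)
      (fun n => Continuous.aestronglyMeasurable (by fun_prop)) ?_ ?_ ?_ ?_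
    · refine fun n => Eventually.of_forall fun z _ => ?_
      rw [norm_mul]
      exact (mul_le_of_le_one_right (norm_nonneg _) (abs_sin_le_one _)).trans (hbd n z)
    · exact Eventually.of_forall fun z _ => hs2
    · exact intervalIntegrable_const
    · exact Eventually.of_forall fun z _ =>
        (Summable.of_norm_bounded hs2 fun n => hbd n z).hasSum.mul_right _
  refine key.unique ?_
  have hterm : ∀ n, ∫ z in (0 : ℝ)..1, 2 * sineCoeff f n * sin (freq n * z) * sin (freq m * z)
      = 2 * sineCoeff f n * (if m = n then 1 / 2 else 0) := by
    intro n
    exact (sineCoeff_const_mul _ _ m).trans (by rw [sineCoeff_sin n m])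
  simp only [hterm]
  have := hasSum_single (f := fun n => 2 * sineCoeff f n * (if m = n then (1 : ℝ) / 2 else 0)) m
    fun k hk => by simp [Ne.symm hk]
  rw [if_pos rfl, mul_one_div, mul_div_cancel_left₀ _ two_ne_zero] at this
  exact this

/-! ### The gain as the norm of a steady state -/

/-- The gain in terms of the `L²` norm of a steady state. -/
lemma hasSum_gain_series {D c : ℝ} {W W1 W2 : ℝ → ℝ} (h : IsC2Data W W1 W2)
    (hζ : ∀ z, W2 z = √(c / D) ^ 2 * W z) (h0 : W 0 = 1) (h1 : W 1 = 0) :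
    HasSum (fun n : ℕ => ((n : ℝ) + 1) ^ 2 / (√(c / D) ^ 2 / π ^ 2 + ((n : ℝ) + 1) ^ 2) ^ 2)
      (π ^ 2 / 2 * ∫ z in (0 : ℝ)..1, W z ^ 2) := by
  have P := (hasSum_sq_sineCoeff h.cont.continuousOn).mul_left (π ^ 2 / 2)
  convert! P using 1
  funext n
  -- The steady state equation becomes a linear equation for the n-th coefficient, solved by
  -- freq/(ζ² + freq²).
  have e := h.sineCoeff_deriv2 n
  rw [funext hζ, sineCoeff_const_mul, h0, h1] at e
  have hf := freq_pos n
  have hden : 0 < √(c / D) ^ 2 + freq n ^ 2 := by positivity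
  have e2 : sineCoeff W n = freq n / (√(c / D) ^ 2 + freq n ^ 2) := by
    rw [eq_div_iff hden.ne']; linear_combination e
  rw [e2]
  have hpi := pi_pos
  have e3 : √(c / D) ^ 2 / π ^ 2 + ((n : ℝ) + 1) ^ 2 = (√(c / D) ^ 2 + freq n ^ 2) / π ^ 2 := by
    unfold freq; field_simp
  rw [e3, div_pow, div_pow, div_div_eq_mul_div]
  rw [show freq n ^ 2 = ((n : ℝ) + 1) ^ 2 * π ^ 2 by unfold freq; ring] at *
  field_simp

lemma gain_eq {D c : ℝ} {W W1 W2 : ℝ → ℝ} (h : IsC2Data W W1 W2)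
    (hζ : ∀ z, W2 z = √(c / D) ^ 2 * W z) (h0 : W 0 = 1) (h1 : W 1 = 0) :
    gain D c = √(∫ z in (0 : ℝ)..1, W z ^ 2) := by
  have hpi := pi_pos
  rw [gain, (hasSum_gain_series h hζ h0 h1).tsum_eq, sqrt_mul (by positivity),
    sqrt_div (by positivity), sqrt_sq hpi.le]
  have : √2 ≠ 0 := by positivity
  field_simp

lemma gain_zero (D : ℝ) : gain D 0 = 1 / √3 := by
  rw [gain_eq (W := fun z => 1 - z) (W1 := fun _ => -1) (W2 := fun _ => 0)
    ⟨fun z => by simpa using (hasDerivAt_id z).const_sub 1, fun z => hasDerivAt_const z _,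
      continuous_const⟩ (by simp) (by simp) (by simp)]
  have : ∫ z in (0 : ℝ)..1, (1 - z) ^ 2 = 1 / 3 := by
    rw [intervalIntegral.integral_comp_sub_left (fun z => z ^ 2) 1]
    simp; norm_num
  rw [this, sqrt_div (by norm_num), sqrt_one]

/-- The steady state is sinh(ζ(1-z))/sinh ζ. Its squared norm follows from an antiderivative of
sinh²; the rest is algebra in E = e^ζ. -/
lemma gain_of_pos {D c : ℝ} (hD : 0 < D) (hc : 0 < c) :
    gain D c = 1 / (exp (2 * √(c / D)) - 1) *
      √((exp (4 * √(c / D)) - 1 - 4 * √(c / D) * exp (2 * √(c / D))) / (2 * √(c / D))) := by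
  have hζ : 0 < √(c / D) := by positivity
  have hW := gain_eq (D := D) (c := c)
    (W := fun z => sinh (√(c / D) * (1 - z)) / sinh √(c / D))
    (W1 := fun z => -√(c / D) * cosh (√(c / D) * (1 - z)) / sinh √(c / D))
    (W2 := fun z => √(c / D) ^ 2 * (sinh (√(c / D) * (1 - z)) / sinh √(c / D)))
  set ζ := √(c / D)
  have hs : 0 < sinh ζ := sinh_pos_iff.2 hζ
  have hl : ∀ z, HasDerivAt (fun z => ζ * (1 - z)) (-ζ) z := fun z => by
    simpa using ((hasDerivAt_id z).const_sub 1).const_mul ζ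
  rw [hW ⟨fun z => ((hl z).sinh.div_const _).congr_deriv (by ring),
    fun z => (((hl z).cosh.const_mul (-ζ)).div_const _).congr_deriv (by ring), by fun_prop⟩
    (fun z => rfl) (by simp [hs.ne']) (by simp)]
  have hE : 1 < exp (2 * ζ) := by rw [← exp_zero]; exact exp_lt_exp.2 (by linarith)
  have hE' : 0 < exp (2 * ζ) - 1 := by linarith
  have hint : ∫ z in (0 : ℝ)..1, (sinh (ζ * (1 - z)) / sinh ζ) ^ 2 =
      (sinh ζ * cosh ζ / (2 * ζ) - 1 / 2) / sinh ζ ^ 2 := by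
    have hd : ∀ z, HasDerivAt (fun z => (-(sinh (ζ * (1 - z)) * cosh (ζ * (1 - z))) / (2 * ζ) - z / 2)
        / sinh ζ ^ 2) ((sinh (ζ * (1 - z)) / sinh ζ) ^ 2) z := by
      intro z
      have := (((((hl z).sinh.mul (hl z).cosh).neg.div_const (2 * ζ)).sub
        ((hasDerivAt_id z).div_const 2)).div_const (sinh ζ ^ 2))
      refine this.congr_deriv ?_
      have := cosh_sq (ζ * (1 - z))
      field_simp
      rw [this]
      ring
    rw [integral_eq_sub_of_hasDerivAt (fun z _ => hd z)
      (Continuous.intervalIntegrable (by fun_prop) _ _)]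
    simp
    ring
  rw [hint]
  have hroot : ∀ A, 1 / (exp (2 * ζ) - 1) * √A = √(A / (exp (2 * ζ) - 1) ^ 2) := fun A => by
    rw [sqrt_div' _ (sq_nonneg _), sqrt_sq hE'.le]; ring
  rw [hroot]
  congr 1
  have e4 : exp (4 * ζ) = exp ζ ^ 4 := by rw [← exp_nat_mul]; push_cast; rfl
  have e2 : exp (2 * ζ) = exp ζ ^ 2 := by rw [← exp_nat_mul]; push_cast; rfl
  rw [e2] at hE'
  rw [sinh_eq] at hs
  rw [e4, e2, sinh_eq, cosh_eq, exp_neg] at *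
  have h3 := exp_pos ζ
  generalize exp ζ = E at *
  have : E - E⁻¹ = (E ^ 2 - 1) / E := by field_simp
  have h4 : E + E⁻¹ = (E ^ 2 + 1) / E := by field_simp
  rw [this, h4]
  field_simp
  ring

/-! ### Entire power series and the Bessel function I₁ -/

/-- The coefficients of an everywhere convergent power series. -/
def IsEntireCoeff (a : ℕ → ℝ) : Prop := ∀ R : ℝ, Summable fun m => ‖a m * R ^ m‖

/-- The factor m + 1 ≤ 2^(m+1) is absorbed by doubling the radius, which costs nothing when every
radius is allowed. -/
lemma IsEntireCoeff.shift {a : ℕ → ℝ} (ha : IsEntireCoeff a) :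
    IsEntireCoeff fun m => ((m : ℝ) + 1) * a (m + 1) := by
  intro R
  have h := (summable_nat_add_iff 1).2 (ha (2 * (|R| + 1)))
  refine h.of_nonneg_of_le (fun _ => norm_nonneg _) fun m => ?_
  have h1 : ((m : ℝ) + 1) ≤ 2 ^ (m + 1) := by
    have := (Nat.lt_two_pow_self (n := m + 1)).le
    exact_mod_cast this
  have h2 : |R| ^ m ≤ (|R| + 1) ^ (m + 1) :=
    (pow_le_pow_left₀ (abs_nonneg R) (by linarith) m).trans
      (pow_le_pow_right₀ (by linarith [abs_nonneg R]) (Nat.le_succ m))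
  rw [norm_mul, norm_mul, norm_mul, norm_pow, norm_pow, norm_eq_abs, norm_eq_abs, norm_eq_abs,
    norm_eq_abs, abs_of_nonneg (by positivity : (0 : ℝ) ≤ (m : ℝ) + 1),
    abs_of_nonneg (by positivity : (0 : ℝ) ≤ 2 * (|R| + 1)), mul_pow]
  calc ((m : ℝ) + 1) * |a (m + 1)| * |R| ^ m = |a (m + 1)| * (((m : ℝ) + 1) * |R| ^ m) := by ring
    _ ≤ |a (m + 1)| * (2 ^ (m + 1) * (|R| + 1) ^ (m + 1)) := by gcongr

lemma IsEntireCoeff.hasDerivAt {a : ℕ → ℝ} (ha : IsEntireCoeff a) (w : ℝ) :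
    HasDerivAt (fun w => ∑' m, a m * w ^ m) (∑' m : ℕ, ((m : ℝ) + 1) * a (m + 1) * w ^ m) w := by
  set R := |w| + 1
  have hR : 0 ≤ R := by positivity
  have hu : Summable fun m : ℕ => ‖a m * ((m : ℝ) * R ^ (m - 1))‖ := by
    rw [← summable_nat_add_iff 1]
    refine (ha.shift R).congr fun m => ?_
    push_cast
    congr 1; ring
  have hw : w ∈ Ioo (-R) R := by
    constructor
    · linarith [neg_abs_le w]
    · linarith [le_abs_self w]
  have key := hasDerivAt_tsum_of_isPreconnected (g := fun m w => a m * w ^ m)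
    (g' := fun m w => a m * ((m : ℝ) * w ^ (m - 1))) hu isOpen_Ioo isPreconnected_Ioo
    (fun m y _ => (hasDerivAt_pow m y).const_mul _) (fun m y hy => ?_) hw
    ((ha w).of_norm) hw
  · refine key.congr_deriv ?_
    have hs : Summable fun m : ℕ => a m * ((m : ℝ) * w ^ (m - 1)) := by
      rw [← summable_nat_add_iff 1]
      refine (ha.shift w).of_norm.congr fun m => ?_
      push_cast
      ring
    rw [hs.tsum_eq_zero_add]
    simp only [Nat.cast_zero, zero_mul, mul_zero, zero_add]
    refine tsum_congr fun m => ?_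
    push_cast
    ring
  · rw [norm_mul, norm_mul, norm_mul, norm_mul, norm_pow, norm_pow, norm_of_nonneg hR]
    have : ‖y‖ ≤ R := abs_le.2 ⟨hy.1.le, hy.2.le⟩
    gcongr

/-- The coefficients of `w ↦ I₁(√w) / √w`. -/
noncomputable def besselCoeff (m : ℕ) : ℝ := 1 / (2 * 4 ^ m * m.factorial * (m + 1).factorial)

lemma besselCoeff_pos (m : ℕ) : 0 < besselCoeff m := by
  unfold besselCoeff; positivity

lemma isEntireCoeff_bessel : IsEntireCoeff besselCoeff := by
  intro R
  refine (Real.summable_pow_div_factorial |R|).of_nonneg_of_le (fun _ => norm_nonneg _) fun m => ?_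
  rw [norm_mul, norm_pow, norm_eq_abs, norm_eq_abs, abs_of_pos (besselCoeff_pos m), mul_comm,
    div_eq_mul_inv]
  refine mul_le_mul_of_nonneg_left ?_ (by positivity)
  rw [besselCoeff, one_div]
  refine inv_anti₀ (by positivity) ?_
  have h1 : (1 : ℝ) ≤ 2 * 4 ^ m := by
    have : (1 : ℝ) ≤ 4 ^ m := one_le_pow₀ (by norm_num)
    linarith
  have h2 : (1 : ℝ) ≤ (m + 1).factorial := by exact_mod_cast Nat.succ_le_of_lt (Nat.factorial_pos _)
  have h3 : (0 : ℝ) < m.factorial := by positivity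
  calc (m.factorial : ℝ) = 1 * m.factorial * 1 := by ring
    _ ≤ 2 * 4 ^ m * m.factorial * (m + 1).factorial := by gcongr

lemma besselCoeff_succ (m : ℕ) :
    ((m : ℝ) + 1) * (m + 2) * besselCoeff (m + 1) = besselCoeff m / 4 := by
  unfold besselCoeff
  rw [Nat.factorial_succ (m + 1), Nat.factorial_succ m]
  push_cast
  field_simp
  ring

/-- The entire function `w ↦ I₁(√w) / √w`. -/
noncomputable def bessel (w : ℝ) : ℝ := ∑' m, besselCoeff m * w ^ m

/-- The derivative of `bessel`. -/
noncomputable def bessel1 (w : ℝ) : ℝ := ∑' m : ℕ, ((m : ℝ) + 1) * besselCoeff (m + 1) * w ^ m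

/-- The second derivative of `bessel`. -/
noncomputable def bessel2 (w : ℝ) : ℝ :=
  ∑' m : ℕ, ((m : ℝ) + 1) * (((m + 1 : ℕ) + 1) * besselCoeff (m + 1 + 1)) * w ^ m

lemma isC2Data_bessel : IsC2Data bessel bessel1 bessel2 where
  d1 w := isEntireCoeff_bessel.hasDerivAt w
  d2 w := isEntireCoeff_bessel.shift.hasDerivAt w
  cont2 := continuous_iff_continuousAt.2 fun w =>
    (isEntireCoeff_bessel.shift.shift.hasDerivAt w).continuousAt

lemma bessel_zero : bessel 0 = 1 / 2 := by
  rw [bessel, tsum_eq_single 0 (fun m hm => by simp [hm])]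
  simp [besselCoeff]

/-- The recurrence `besselCoeff_succ`, summed. This equation is what makes `besselKernel` satisfy
K_zz - K_ss = lam K. -/
lemma bessel_ode (w : ℝ) : w * bessel2 w + 2 * bessel1 w = bessel w / 4 := by
  have h1 : HasSum (fun m : ℕ => ((m : ℝ) + 1) * m * besselCoeff (m + 1) * w ^ m)
      (w * bessel2 w) := by
    have h := (isEntireCoeff_bessel.shift.shift w).of_norm.hasSum.mul_left w
    rw [← hasSum_nat_add_iff' 1]
    simp only [Finset.sum_range_one, Nat.cast_zero, mul_zero, zero_mul, sub_zero]
    convert! h using 1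
    funext m
    push_cast
    ring
  have h2 := (isEntireCoeff_bessel.shift w).of_norm.hasSum.mul_left 2
  have h3 := (isEntireCoeff_bessel w).of_norm.hasSum.div_const 4
  refine (h1.add h2).unique ?_
  convert! h3 using 1
  funext m
  have := besselCoeff_succ m
  linear_combination w ^ m * this

/-- A Beta integral. Integration by parts moves one power from the first factor to the second, so j
must vary in the induction on i. -/
lemma integral_sub_pow_mul_pow (W : ℝ) (i j : ℕ) :
    ∫ u in (0 : ℝ)..W, (u - W) ^ i * u ^ j =
      (-1) ^ i * (i.factorial * j.factorial / (i + j + 1).factorial) * W ^ (i + j + 1) := by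
  induction i generalizing j with
  | zero =>
    simp only [pow_zero, one_mul, integral_pow, Nat.factorial_zero, Nat.cast_one, zero_add,
      Nat.factorial_succ]
    push_cast
    field_simp
    simp
  | succ i ih =>
    have hd : ∀ u, HasDerivAt (fun u => (u - W) ^ (i + 1) * (u ^ (j + 1) / (j + 1)))
        ((u - W) ^ (i + 1) * u ^ j + ((i + 1) / (j + 1)) * ((u - W) ^ i * u ^ (j + 1))) u := by
      intro u
      have := (((hasDerivAt_id u).sub_const W).pow (i + 1)).mul
        (((hasDerivAt_id u).pow (j + 1)).div_const ((j : ℝ) + 1))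
      refine this.congr_deriv ?_
      simp only [id, Nat.add_sub_cancel, mul_one, Pi.pow_apply]
      push_cast
      field_simp
      ring
    have key := integral_eq_sub_of_hasDerivAt (a := 0) (b := W) (fun u _ => hd u)
      (Continuous.intervalIntegrable (by fun_prop) _ _)
    rw [intervalIntegral.integral_add (Continuous.intervalIntegrable (by fun_prop) _ _)
      (Continuous.intervalIntegrable (by fun_prop) _ _), intervalIntegral.integral_const_mul,
      ih] at key
    simp only [sub_self, ne_eq, Nat.add_eq_zero_iff, one_ne_zero, and_false, not_false_eq_true,
      zero_pow, zero_mul, zero_div, mul_zero] at key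
    rw [show i + (j + 1) + 1 = i + 1 + j + 1 by ring, Nat.factorial_succ j] at key
    rw [Nat.factorial_succ i]
    push_cast at key ⊢
    rw [eq_neg_of_add_eq_zero_left key]
    field_simp
    ring

/-- After multiplication by (n+2)! the terms are alternating binomial coefficients of n+2. The full
alternating sum is 0, and only its two end terms are missing here; they form the right-hand side. -/
lemma sum_antidiagonal_alternating (n : ℕ) :
    ∑ p ∈ Finset.HasAntidiagonal.antidiagonal n, (-1 : ℝ) ^ p.1 / ((p.1 + 1).factorial * (p.2 + 1).factorial) =
      (1 + (-1) ^ n) / (n + 2).factorial := by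
  have h := Int.alternating_sum_range_choose (n := n + 2)
  rw [if_neg (by omega), Finset.sum_range_succ, Finset.sum_range_succ'] at h
  have h' : ∑ k ∈ Finset.range (n + 1), (-1 : ℝ) ^ (k + 1) * ((n + 2).choose (k + 1) : ℝ) + 1 +
      (-1) ^ (n + 2) = 0 := by
    have := congrArg (Int.cast : ℤ → ℝ) h
    push_cast at this
    simpa using this
  rw [Finset.Nat.sum_antidiagonal_eq_sum_range_succ
    (fun i j => (-1 : ℝ) ^ i / ((i + 1).factorial * (j + 1).factorial)), eq_div_iff (by positivity),
    Finset.sum_mul]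
  have hterm : ∀ k ∈ Finset.range (n + 1),
      (-1 : ℝ) ^ k / ((k + 1).factorial * (n - k + 1).factorial) * (n + 2).factorial =
      -((-1 : ℝ) ^ (k + 1) * ((n + 2).choose (k + 1) : ℝ)) := by
    intro k hk
    have hk' : k ≤ n := Nat.lt_succ_iff.1 (Finset.mem_range.1 hk)
    rw [Nat.cast_choose ℝ (show k + 1 ≤ n + 2 by omega), show n + 2 - (k + 1) = n - k + 1 by omega]
    field_simp
    ring
  rw [Finset.sum_congr rfl hterm, Finset.sum_neg_distrib]
  linear_combination -h'

/-- The convolution identity behind the inversion of the Bessel kernels. -/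
lemma bessel_convolution (W : ℝ) :
    ∫ u in (0 : ℝ)..W, bessel (u - W) * bessel u = 2 * (bessel W - bessel (-W)) := by
  -- For u between 0 and W both |u| and |u - W| are at most R, so one Cauchy product at R dominates
  -- the series on the whole interval.
  set R := 2 * |W|
  have hA : Summable fun m => ‖besselCoeff m * R ^ m‖ := isEntireCoeff_bessel R
  have hbound := summable_norm_sum_mul_antidiagonal_of_summable_norm hA hA
  have key : HasSum (fun n => ∫ u in (0 : ℝ)..W, ∑ p ∈ Finset.HasAntidiagonal.antidiagonal n,
      (besselCoeff p.1 * (u - W) ^ p.1) * (besselCoeff p.2 * u ^ p.2))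
      (∫ u in (0 : ℝ)..W, bessel (u - W) * bessel u) := by
    refine hasSum_integral_of_dominated_convergence (fun n _ => ‖∑ p ∈ Finset.HasAntidiagonal.antidiagonal n,
      (besselCoeff p.1 * R ^ p.1) * (besselCoeff p.2 * R ^ p.2)‖)
      (fun n => Continuous.aestronglyMeasurable (by fun_prop)) ?_ ?_ ?_ ?_
    · refine fun n => Eventually.of_forall fun u hu => ?_
      have hu1 : |u| ≤ |W| := by
        have := uIoc_subset_uIcc hu
        simpa using abs_sub_left_of_mem_uIcc this
      have hu2 : |u - W| ≤ R := (abs_sub _ _).trans (by simp only [R]; linarith)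
      have hu3 : |u| ≤ R := hu1.trans (by simp only [R]; linarith [abs_nonneg W])
      have hR : 0 ≤ R := by positivity
      refine (norm_sum_le _ _).trans ?_
      refine le_trans (Finset.sum_le_sum fun p _ => ?_) (le_norm_self _)
      rw [norm_mul, norm_mul, norm_mul, norm_pow, norm_pow, norm_of_nonneg (besselCoeff_pos _).le,
        norm_of_nonneg (besselCoeff_pos _).le, norm_eq_abs, norm_eq_abs]
      have := besselCoeff_pos p.1
      have := besselCoeff_pos p.2
      gcongr
    · exact Eventually.of_forall fun _ _ => hbound
    · exact intervalIntegrable_const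
    · refine Eventually.of_forall fun u _ => ?_
      have h1 := isEntireCoeff_bessel (u - W)
      have h2 := isEntireCoeff_bessel u
      rw [bessel, bessel, tsum_mul_tsum_eq_tsum_sum_antidiagonal_of_summable_norm h1 h2]
      exact (summable_norm_sum_mul_antidiagonal_of_summable_norm h1 h2).of_norm.hasSum
  -- The degree n part of the Cauchy product integrates to a multiple of (1 + (-1)^n) W^(n+1). Only
  -- odd powers of W survive, as in bessel W - bessel (-W), and the degree rises by one.
  have hterm : ∀ n, ∫ u in (0 : ℝ)..W, ∑ p ∈ Finset.HasAntidiagonal.antidiagonal n,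
      (besselCoeff p.1 * (u - W) ^ p.1) * (besselCoeff p.2 * u ^ p.2) =
      2 * (besselCoeff (n + 1) * W ^ (n + 1) - besselCoeff (n + 1) * (-W) ^ (n + 1)) := by
    intro n
    rw [intervalIntegral.integral_finsetSum
      (fun p _ => Continuous.intervalIntegrable (by fun_prop) _ _)]
    have h1 : ∀ p ∈ Finset.HasAntidiagonal.antidiagonal n, ∫ u in (0 : ℝ)..W,
        (besselCoeff p.1 * (u - W) ^ p.1) * (besselCoeff p.2 * u ^ p.2) =
        W ^ (n + 1) / (4 * 4 ^ n * (n + 1).factorial) *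
          ((-1 : ℝ) ^ p.1 / ((p.1 + 1).factorial * (p.2 + 1).factorial)) := by
      intro p hp
      obtain ⟨i, j⟩ := p
      have hn : i + j = n := Finset.HasAntidiagonal.mem_antidiagonal.1 hp
      have : ∀ u, (besselCoeff i * (u - W) ^ i) * (besselCoeff j * u ^ j) =
          (besselCoeff i * besselCoeff j) * ((u - W) ^ i * u ^ j) := fun u => by ring
      simp only [this]
      rw [intervalIntegral.integral_const_mul, integral_sub_pow_mul_pow, hn, ← hn, pow_add 4 i j]
      unfold besselCoeff
      field_simp
      ring
    rw [Finset.sum_congr rfl h1, ← Finset.mul_sum, sum_antidiagonal_alternating, besselCoeff,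
      neg_pow W]
    field_simp
    ring
  simp only [hterm] at key
  have hs : HasSum (fun m => 2 * (besselCoeff m * W ^ m - besselCoeff m * (-W) ^ m))
      (2 * (bessel W - bessel (-W))) :=
    ((isEntireCoeff_bessel W).of_norm.hasSum.sub
      (isEntireCoeff_bessel (-W)).of_norm.hasSum).mul_left 2
  rw [← hasSum_nat_add_iff' 1] at hs
  simp only [Finset.sum_range_one, pow_zero, sub_self, mul_zero, sub_zero] at hs
  exact key.unique hs

/-! ### Volterra transformations -/

lemma volterra_congr {κ K : ℝ → ℝ → ℝ} {f F : ℝ → ℝ}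
    (hK : ∀ z ∈ Icc (0 : ℝ) 1, ∀ s ∈ Icc (0 : ℝ) 1, K z s = κ z s) (hF : EqOn F f (Icc 0 1))
    {z : ℝ} (hz : z ∈ Icc (0 : ℝ) 1) : volterra κ f z = volterra K F z := by
  unfold volterra
  rw [hF hz]
  congr 1
  refine integral_congr fun s hs => ?_
  rw [uIcc_of_le hz.2] at hs
  have hs' : s ∈ Icc (0 : ℝ) 1 := ⟨hz.1.trans hs.1, hs.2⟩
  simp only [hK z hz s hs', hF hs']

lemma continuous_volterra {K : ℝ → ℝ → ℝ} (hK : Continuous (Function.uncurry K)) {f : ℝ → ℝ}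
    (hf : Continuous f) : Continuous (volterra K f) := by
  unfold volterra
  exact hf.add (continuous_integral_lower (by fun_prop) continuous_id 1)

lemma hasDerivAt_integral_kernel {K K1 : ℝ → ℝ → ℝ} (hK : Continuous (Function.uncurry K))
    (hK1 : Continuous (Function.uncurry K1)) (hd : ∀ s z, HasDerivAt (fun z => K z s) (K1 z s) z)
    {f : ℝ → ℝ} (hf : Continuous f) (z : ℝ) :
    HasDerivAt (fun z => ∫ s in z..1, K z s * f s)
      (-(K z z * f z) + ∫ s in z..1, K1 z s * f s) z :=
  hasDerivAt_integral_lower (g := fun z s => K z s * f s) (g1 := fun z s => K1 z s * f s)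
    (by fun_prop) (by fun_prop) (fun s z => (hd s z).mul_const _) 1 z

lemma continuousOn_volterra {κ : ℝ → ℝ → ℝ} (hκ : IsC2Kernel κ) {f : ℝ → ℝ}
    (hf : ContinuousOn f (Icc 0 1)) : ContinuousOn (volterra κ f) (Icc 0 1) := by
  obtain ⟨K, K1, K2, hK, -, -, -, -, he⟩ := hκ.exists_extension
  have hF : Continuous fun z => f (clamp z) := hf.comp_continuous continuous_clamp clamp_mem
  refine (continuous_volterra hK hF).continuousOn.congr fun z hz =>
    volterra_congr he (fun w hw => by simp only [clamp_of_mem hw]) hz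

/-- The Volterra transformation preserves the class `C²`. -/
lemma contDiffOn_volterra {κ : ℝ → ℝ → ℝ} (hκ : IsC2Kernel κ) {f : ℝ → ℝ}
    (hf : ContDiffOn ℝ 2 f (Icc 0 1)) : ContDiffOn ℝ 2 (volterra κ f) (Icc 0 1) := by
  obtain ⟨K, K1, K2, hK, hK1, hK2, hd, hd1, he⟩ := hκ.exists_extension
  obtain ⟨F, F1, F2, hF, hFe⟩ := exists_C2Data_Icc hf
  suffices h : ContDiffOn ℝ 2 (volterra K F) (Icc 0 1) from
    h.congr fun z hz => volterra_congr he hFe hz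
  have hu := uniqueDiffOn_Icc (zero_lt_one (α := ℝ))
  have hder : ∀ z, HasDerivAt (fun z => ∫ s in z..1, K z s * F s)
      (-(K z z * F z) + ∫ s in z..1, K1 z s * F s) z :=
    hasDerivAt_integral_kernel hK hK1 hd hF.cont
  have hder1 : ∀ z, HasDerivAt (fun z => ∫ s in z..1, K1 z s * F s)
      (-(K1 z z * F z) + ∫ s in z..1, K2 z s * F s) z :=
    hasDerivAt_integral_kernel hK1 hK2 hd1 hF.cont
  have hI1 : ContDiff ℝ 1 fun z => ∫ s in z..1, K1 z s * F s := by
    rw [contDiff_one_iff_deriv]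
    refine ⟨fun z => (hder1 z).differentiableAt, ?_⟩
    rw [funext fun z => (hder1 z).deriv]
    have := hF.cont
    exact Continuous.add (by fun_prop)
      (continuous_integral_lower (f := fun z s => K2 z s * F s) (by fun_prop) continuous_id 1)
  -- The extension K carries no derivative in s, so the regularity of the diagonal is taken from κ
  -- on the square.
  have hdiag : ContDiffOn ℝ 1 (fun z => K z z * F z) (Icc 0 1) := by
    have h1 : ContDiffOn ℝ 2 (fun z => κ z z) (Icc 0 1) :=
      ContDiffOn.comp (g := fun q : ℝ × ℝ => κ q.1 q.2) (f := fun z : ℝ => (z, z)) hκ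
        (contDiff_id.prodMk contDiff_id).contDiffOn fun z hz => ⟨hz, hz⟩
    have h2 : ContDiffOn ℝ 1 (fun z => κ z z * F z) (Icc 0 1) :=
      (h1.of_le (by norm_num)).mul (hF.contDiff.of_le (by norm_num)).contDiffOn
    exact h2.congr fun z hz => by simp only [he z hz z hz]
  refine hF.contDiff.contDiffOn.add ?_
  rw [show (2 : WithTop ℕ∞) = 1 + 1 by norm_num, contDiffOn_succ_iff_derivWithin hu]
  refine ⟨fun z _ => (hder z).differentiableAt.differentiableWithinAt, by simp, ?_⟩
  refine (hdiag.neg.add hI1.contDiffOn).congr fun z hz => ?_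
  exact (hder z).hasDerivWithinAt.derivWithin (hu z hz)

/-- Interchange of the order of integration over a triangle. -/
lemma integral_integral_triangle {G : ℝ → ℝ → ℝ} (hG : Continuous (Function.uncurry G)) (a b : ℝ) :
    ∫ r in a..b, ∫ s in r..b, G r s = ∫ s in a..b, ∫ r in a..s, G r s := by
  have c1 : Continuous fun r => ∫ s in r..b, G r s := continuous_integral_lower hG continuous_id b
  have c2 : Continuous (Function.uncurry fun a s => ∫ r in a..s, G r s) :=
    continuous_integral_interval hG
  -- As functions of a, both sides have derivative -∫_a^b G a s ds, and both vanish at a = b.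
  have d1 : ∀ a, HasDerivAt (fun a => ∫ r in a..b, ∫ s in r..b, G r s) (-∫ s in a..b, G a s) a :=
    fun a => integral_hasDerivAt_left (c1.intervalIntegrable _ _)
      (c1.stronglyMeasurableAtFilter _ _) c1.continuousAt
  have hslice : ∀ s, Continuous fun r => G r s := fun s => by fun_prop
  have d2 : ∀ a, HasDerivAt (fun a => ∫ s in a..b, ∫ r in a..s, G r s)
      (-(∫ r in a..a, G r a) + ∫ s in a..b, -G a s) a := fun a =>
    hasDerivAt_integral_lower (g := fun a s => ∫ r in a..s, G r s) (g1 := fun a s => -G a s) c2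
      (by fun_prop) (fun s z => integral_hasDerivAt_left ((hslice s).intervalIntegrable _ _)
        ((hslice s).stronglyMeasurableAtFilter _ _) (hslice s).continuousAt) b a
  have d : ∀ a, HasDerivAt (fun a => (∫ r in a..b, ∫ s in r..b, G r s) -
      ∫ s in a..b, ∫ r in a..s, G r s) 0 a := fun a => by
    refine ((d1 a).sub (d2 a)).congr_deriv ?_
    rw [intervalIntegral.integral_same, intervalIntegral.integral_neg]; ring
  have := is_const_of_deriv_eq_zero (fun a => (d a).differentiableAt) (fun a => (d a).deriv) a b
  simp only [intervalIntegral.integral_same, sub_self] at this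
  linarith

/-! ### The explicit backstepping kernel and its inverse -/

/-- The backstepping kernel for the reaction coefficient `lam` (normalized by the diffusion). -/
noncomputable def besselKernel (lam z s : ℝ) : ℝ :=
  lam * (1 - s) * bessel (lam * ((1 - z) ^ 2 - (1 - s) ^ 2))

lemma isC2Kernel_besselKernel (lam : ℝ) : IsC2Kernel (besselKernel lam) := by
  have h := isC2Data_bessel.contDiff
  refine ContDiff.contDiffOn ?_
  unfold besselKernel
  refine ContDiff.mul (by fun_prop) (h.comp (by fun_prop))

lemma continuous_besselKernel (lam : ℝ) : Continuous (Function.uncurry (besselKernel lam)) := by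
  have h := isC2Data_bessel.cont
  simp only [Function.uncurry_def]
  unfold besselKernel
  fun_prop

lemma besselKernel_diag (lam z : ℝ) : besselKernel lam z z = lam * (1 - z) / 2 := by
  simp [besselKernel, bessel_zero]; ring

/-- The kernel satisfies K_zz - K_ss = lam K, K(z,z) = lam(1-z)/2 and K(z,1) = 0. Differentiating
T_K y twice produces K_zz and diagonal terms; Green's formula in s moves y'' onto K. The terms at s
= 1 vanish by y(1) = 0 and K(z,1) = 0, those at s = z cancel, and the wave equation leaves D lam = p
+ c times T_K y. -/
lemma isBacksteppingKernel_besselKernel {D : ℝ} (hD : D ≠ 0) (p c : ℝ) :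
    IsBacksteppingKernel D p c (besselKernel ((p + c) / D)) := by
  set lam := (p + c) / D with hlam
  have hDlam : D * lam = p + c := by rw [hlam]; field_simp
  refine ⟨isC2Kernel_besselKernel lam, fun y hy hy1 z hz => ?_⟩
  obtain ⟨Y, Y1, Y2, hY, hYe⟩ := exists_C2Data_Icc hy
  have cY := hY.cont
  have cY1 := hY.cont1
  have cY2 := hY.cont2
  have cb := isC2Data_bessel.cont
  have cb1 := isC2Data_bessel.cont1
  have cb2 := isC2Data_bessel.cont2
  have hYone : Y 1 = 0 := by rw [hYe ⟨zero_le_one, le_rfl⟩, hy1]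
  set w : ℝ → ℝ → ℝ := fun z s => lam * ((1 - z) ^ 2 - (1 - s) ^ 2) with hw
  set K := besselKernel lam with hK
  have hKdef : ∀ z s, K z s = lam * (1 - s) * bessel (w z s) := fun z s => rfl
  set K1 : ℝ → ℝ → ℝ := fun z s => -2 * lam ^ 2 * (1 - s) * (1 - z) * bessel1 (w z s) with hK1
  set K2 : ℝ → ℝ → ℝ := fun z s => 2 * lam ^ 2 * (1 - s) * bessel1 (w z s) +
    4 * lam ^ 3 * (1 - s) * (1 - z) ^ 2 * bessel2 (w z s) with hK2
  set S1 : ℝ → ℝ → ℝ := fun z s => -lam * bessel (w z s) +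
    2 * lam ^ 2 * (1 - s) ^ 2 * bessel1 (w z s) with hS1
  set S2 : ℝ → ℝ → ℝ := fun z s => -6 * lam ^ 2 * (1 - s) * bessel1 (w z s) +
    4 * lam ^ 3 * (1 - s) ^ 3 * bessel2 (w z s) with hS2
  have cK : Continuous (Function.uncurry K) := continuous_besselKernel lam
  have cK1 : Continuous (Function.uncurry K1) := by simp only [Function.uncurry_def, K1, w]; fun_prop
  have cK2 : Continuous (Function.uncurry K2) := by simp only [Function.uncurry_def, K2, w]; fun_prop
  have cS2 : Continuous (Function.uncurry S2) := by simp only [Function.uncurry_def, S2, w]; fun_prop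
  have dz : ∀ s z, HasDerivAt (fun z => w z s) (-2 * lam * (1 - z)) z := fun s z => by
    refine ((((((hasDerivAt_id z).const_sub 1).pow 2).sub_const _).const_mul lam)).congr_deriv ?_
    simp; ring
  have ds : ∀ z s, HasDerivAt (fun s => w z s) (2 * lam * (1 - s)) s := fun z s => by
    refine ((((((hasDerivAt_id s).const_sub 1).pow 2).const_sub _).const_mul lam)).congr_deriv ?_
    simp; ring
  have hb := fun z s => isC2Data_bessel.d1 (w z s)
  have hb1 := fun z s => isC2Data_bessel.d2 (w z s)
  have dK : ∀ s z, HasDerivAt (fun z => K z s) (K1 z s) z := fun s z => by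
    refine (((hb z s).comp z (dz s z)).const_mul (lam * (1 - s))).congr_deriv ?_
    simp only [K1]; ring
  have dK1 : ∀ s z, HasDerivAt (fun z => K1 z s) (K2 z s) z := fun s z => by
    have := (((hasDerivAt_id z).const_sub 1).const_mul (-2 * lam ^ 2 * (1 - s))).mul
      ((hb1 z s).comp z (dz s z))
    refine this.congr_deriv ?_
    simp only [K2, id, Function.comp]; ring
  have dS : ∀ z s, HasDerivAt (fun s => K z s) (S1 z s) s := fun z s => by
    have := (((hasDerivAt_id s).const_sub 1).const_mul lam).mul ((hb z s).comp s (ds z s))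
    refine this.congr_deriv ?_
    simp only [S1, id, Function.comp]; ring
  have dS1 : ∀ z s, HasDerivAt (fun s => S1 z s) (S2 z s) s := fun z s => by
    have := (((hb z s).comp s (ds z s)).const_mul (-lam)).add
      (((((hasDerivAt_id s).const_sub 1).pow 2).const_mul (2 * lam ^ 2)).mul
        ((hb1 z s).comp s (ds z s)))
    refine this.congr_deriv ?_
    simp only [S2, id, Function.comp, Pi.pow_apply]; ring
  -- The left side is 4 lam² (1-s) (w bessel2(w) + 2 bessel1(w)), to which `bessel_ode` applies.
  have wave : ∀ z s, K2 z s - S2 z s = lam * K z s := fun z s => by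
    have := bessel_ode (w z s)
    simp only [hKdef, K2, S2]
    have e : w z s = lam * ((1 - z) ^ 2 - (1 - s) ^ 2) := rfl
    linear_combination 4 * lam ^ 2 * (1 - s) * this - 4 * lam ^ 2 * (1 - s) * bessel2 (w z s) * e
  have hdiag : ∀ z, K z z = lam * (1 - z) / 2 := besselKernel_diag lam
  -- derivatives of the transformed profile
  have hF : IsC2Data (volterra K Y)
      (fun z => Y1 z + (-(lam * (1 - z) / 2 * Y z) + ∫ s in z..1, K1 z s * Y s))
      (fun z => Y2 z + (-(lam * (-1) / 2 * Y z + lam * (1 - z) / 2 * Y1 z) +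
        (-(K1 z z * Y z) + ∫ s in z..1, K2 z s * Y s))) := by
    refine ⟨fun z => ?_, fun z => ?_, ?_⟩
    · have := (hY.d1 z).add (hasDerivAt_integral_kernel cK cK1 dK cY z)
      rw [hdiag] at this
      exact this
    · have h1 : HasDerivAt (fun z => lam * (1 - z) / 2) (lam * (-1) / 2) z :=
        ((((hasDerivAt_id z).const_sub 1).const_mul lam).div_const 2)
      exact (hY.d2 z).add ((h1.mul (hY.d1 z)).neg.add
        (hasDerivAt_integral_kernel cK1 cK2 dK1 cY z))
    · have := continuous_integral_lower (f := fun z s => K2 z s * Y s) (by fun_prop)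
        continuous_id 1
      have h3 : Continuous fun z => K1 z z := by simp only [K1, w]; fun_prop
      exact cY2.add (Continuous.add (by fun_prop) (Continuous.add (by fun_prop) this))
  have hzI : z ∈ Icc (0 : ℝ) 1 := Ioo_subset_Icc_self hz
  have hvol : ∀ z ∈ Icc (0 : ℝ) 1, volterra K y z = volterra K Y z := fun z hz =>
    volterra_congr (fun _ _ _ _ => rfl) hYe hz
  have hy2 : ∀ s ∈ Ioo (0 : ℝ) 1, deriv (deriv y) s = Y2 s := fun s hs =>
    hY.deriv2 isOpen_Ioo (fun r hr => (hYe (Ioo_subset_Icc_self hr)).symm) hs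
  rw [hF.deriv2 isOpen_Ioo (fun r hr => hvol r (Ioo_subset_Icc_self hr)) hz, hvol z hzI]
  have hright : volterra K (fun s => D * deriv (deriv y) s + p * y s) z =
      D * Y2 z + p * Y z + ∫ s in z..1, K z s * (D * Y2 s + p * Y s) := by
    unfold volterra
    beta_reduce
    rw [hy2 z hz, hYe hzI]
    congr 1
    -- Integrate over the open interval: at s = 1 the two-sided derivative of y depends on values
    -- outside [0,1].
    rw [integral_of_le hz.2.le, integral_of_le hz.2.le, integral_Ioc_eq_integral_Ioo,
      integral_Ioc_eq_integral_Ioo]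
    refine setIntegral_congr_fun measurableSet_Ioo fun s hs => ?_
    have hs' : s ∈ Ioo (0 : ℝ) 1 := ⟨hz.1.trans hs.1, hs.2⟩
    simp only [hy2 s hs', hYe (Ioo_subset_Icc_self hs')]
  rw [hright]
  have ii : ∀ f : ℝ → ℝ, Continuous f → IntervalIntegrable f volume z 1 := fun f hf =>
    hf.intervalIntegrable _ _
  have cKz : Continuous (K z) := by fun_prop
  have cSz : Continuous (S2 z) := by fun_prop
  have cK2z : Continuous (K2 z) := by fun_prop
  -- Green's formula
  have green : (∫ s in z..1, K z s * Y2 s) - ∫ s in z..1, S2 z s * Y s =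
      S1 z z * Y z - K z z * Y1 z := by
    have hd : ∀ s, HasDerivAt (fun s => K z s * Y1 s - S1 z s * Y s)
        (K z s * Y2 s - S2 z s * Y s) s := fun s => by
      refine (((dS z s).mul (hY.d2 s)).sub ((dS1 z s).mul (hY.d1 s))).congr_deriv ?_
      ring
    rw [← intervalIntegral.integral_sub (ii _ (by fun_prop)) (ii _ (by fun_prop)),
      integral_eq_sub_of_hasDerivAt (fun s _ => hd s) (ii _ (by fun_prop)), hYone, hKdef z 1]
    ring
  have hwave : (∫ s in z..1, K2 z s * Y s) - ∫ s in z..1, S2 z s * Y s =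
      lam * ∫ s in z..1, K z s * Y s := by
    rw [← intervalIntegral.integral_sub (ii _ (by fun_prop)) (ii _ (by fun_prop)),
      ← intervalIntegral.integral_const_mul]
    refine integral_congr fun s _ => ?_
    have := wave z s
    linear_combination Y s * this
  have hsplit : ∫ s in z..1, K z s * (D * Y2 s + p * Y s) =
      D * (∫ s in z..1, K z s * Y2 s) + p * ∫ s in z..1, K z s * Y s := by
    rw [← intervalIntegral.integral_const_mul, ← intervalIntegral.integral_const_mul,
      ← intervalIntegral.integral_add (ii _ (by fun_prop)) (ii _ (by fun_prop))]
    refine integral_congr fun s _ => ?_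
    ring
  -- K_s + K_z on the diagonal is the derivative of z ↦ K z z.
  have hS1K1 : S1 z z + K1 z z = -lam / 2 := by
    have : w z z = 0 := by simp [w]
    simp only [S1, K1, this, bessel_zero]; ring
  rw [hsplit, volterra]
  have hKz := hdiag z
  linear_combination D * hwave - D * green - D * Y z * hS1K1 + D * Y1 z * hKz
    + (Y z + ∫ s in z..1, K z s * Y s) * hDlam

/-- The left side is the kernel of T_l T_k minus the identity, with l the kernel for -lam.
Substituting u = lam((1-r)² - (1-s)²), whose differential supplies the factor 1 - r, turns the
integral into `bessel_convolution`. -/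
lemma besselKernel_convolution (lam z s : ℝ) :
    besselKernel lam z s + besselKernel (-lam) z s +
      ∫ r in z..s, besselKernel (-lam) z r * besselKernel lam r s = 0 := by
  set W := lam * ((1 - z) ^ 2 - (1 - s) ^ 2) with hW
  have cb := isC2Data_bessel.cont
  have hsub : ∫ r in z..s, bessel (lam * ((1 - r) ^ 2 - (1 - s) ^ 2) - W) *
      bessel (lam * ((1 - r) ^ 2 - (1 - s) ^ 2)) * (-2 * lam * (1 - r)) =
      -(2 * (bessel W - bessel (-W))) := by
    have hd : ∀ r, HasDerivAt (fun r => lam * ((1 - r) ^ 2 - (1 - s) ^ 2)) (-2 * lam * (1 - r)) r :=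
      fun r => by
        refine ((((((hasDerivAt_id r).const_sub 1).pow 2).sub_const _).const_mul lam)).congr_deriv ?_
        simp; ring
    have := integral_comp_mul_deriv (a := z) (b := s)
      (f := fun r => lam * ((1 - r) ^ 2 - (1 - s) ^ 2)) (f' := fun r => -2 * lam * (1 - r))
      (g := fun u => bessel (u - W) * bessel u) (fun r _ => hd r) (by fun_prop) (by fun_prop)
    simp only [Function.comp_def] at this
    rw [this, sub_self, mul_zero, ← hW, intervalIntegral.integral_symm, bessel_convolution]
  have hint : ∫ r in z..s, besselKernel (-lam) z r * besselKernel lam r s =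
      lam * (1 - s) / 2 * ∫ r in z..s, bessel (lam * ((1 - r) ^ 2 - (1 - s) ^ 2) - W) *
      bessel (lam * ((1 - r) ^ 2 - (1 - s) ^ 2)) * (-2 * lam * (1 - r)) := by
    rw [← intervalIntegral.integral_const_mul]
    refine integral_congr fun r _ => ?_
    have e : -lam * ((1 - z) ^ 2 - (1 - r) ^ 2) = lam * ((1 - r) ^ 2 - (1 - s) ^ 2) - W := by
      rw [hW]; ring
    simp only [besselKernel, e]
    ring
  rw [hint, hsub, besselKernel, besselKernel, ← hW,
    show -lam * ((1 - z) ^ 2 - (1 - s) ^ 2) = -W by rw [hW]; ring]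
  ring

/-- Exchanging the integrations over the triangle collects all integral terms into one Volterra
integral, whose kernel vanishes by `besselKernel_convolution`. -/
lemma volterra_besselKernel_neg (lam : ℝ) {f : ℝ → ℝ} (hf : Continuous f) (z : ℝ) :
    volterra (besselKernel (-lam)) (volterra (besselKernel lam) f) z = f z := by
  have ck := continuous_besselKernel lam
  have cl := continuous_besselKernel (-lam)
  have c1 : Continuous (besselKernel lam z) := by fun_prop
  have c2 : Continuous (besselKernel (-lam) z) := by fun_prop
  have c3 : Continuous fun r => ∫ s in r..1, besselKernel lam r s * f s :=
    continuous_integral_lower (f := fun r s => besselKernel lam r s * f s) (by fun_prop)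
      continuous_id 1
  have cG : Continuous (Function.uncurry fun r s =>
      besselKernel (-lam) z r * (besselKernel lam r s * f s)) := by
    simp only [Function.uncurry_def] at ck ⊢; fun_prop
  have cJ : Continuous fun s => ∫ r in z..s, besselKernel (-lam) z r *
      (besselKernel lam r s * f s) :=
    (continuous_integral_interval cG).comp (by fun_prop : Continuous fun s : ℝ => (z, s))
  have ii : ∀ f : ℝ → ℝ, Continuous f → IntervalIntegrable f volume z 1 := fun f hf =>
    hf.intervalIntegrable _ _
  unfold volterra
  have e1 : ∫ r in z..1, besselKernel (-lam) z r *
      (f r + ∫ s in r..1, besselKernel lam r s * f s) =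
      (∫ r in z..1, besselKernel (-lam) z r * f r) +
        ∫ s in z..1, ∫ r in z..s, besselKernel (-lam) z r * (besselKernel lam r s * f s) := by
    rw [← integral_integral_triangle cG, ← intervalIntegral.integral_add (ii _ (by fun_prop))
      (ii _ (by simp only [intervalIntegral.integral_const_mul]; fun_prop))]
    refine integral_congr fun r _ => ?_
    simp only [intervalIntegral.integral_const_mul]; ring
  rw [e1, add_assoc, ← intervalIntegral.integral_add (ii _ (by fun_prop)) (ii _ cJ),
    ← intervalIntegral.integral_add (ii _ (by fun_prop)) (ii _ (by fun_prop))]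
  have e2 : ∫ s in z..1, (besselKernel lam z s * f s + (besselKernel (-lam) z s * f s +
      ∫ r in z..s, besselKernel (-lam) z r * (besselKernel lam r s * f s))) = ∫ s in z..1, (0 : ℝ) := by
    refine integral_congr fun s _ => ?_
    have h := besselKernel_convolution lam z s
    have e3 : ∫ r in z..s, besselKernel (-lam) z r * (besselKernel lam r s * f s) =
        (∫ r in z..s, besselKernel (-lam) z r * besselKernel lam r s) * f s := by
      rw [← intervalIntegral.integral_mul_const]; simp only [mul_assoc]
    simp only [e3]
    linear_combination f s * h
  rw [e2]; simp

/-- Since -(-lam) = lam, a one-sided inverse for every lam is a two-sided one. -/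
lemma isInverseKernel_besselKernel (lam : ℝ) :
    IsInverseKernel (besselKernel lam) (besselKernel (-lam)) := by
  have main : ∀ lam : ℝ, ∀ x y : ℝ → ℝ, ContinuousOn y (Icc 0 1) →
      (∀ z ∈ Icc (0 : ℝ) 1, x z = volterra (besselKernel lam) y z) →
      ∀ z ∈ Icc (0 : ℝ) 1, y z = volterra (besselKernel (-lam)) x z := by
    intro lam x y hy h z hz
    have hF : Continuous fun z => y (clamp z) := hy.comp_continuous continuous_clamp clamp_mem
    have hFe : EqOn (fun z => y (clamp z)) y (Icc 0 1) := fun w hw => by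
      simp only [clamp_of_mem hw]
    rw [volterra_congr (K := besselKernel (-lam))
      (F := volterra (besselKernel lam) fun z => y (clamp z)) (fun _ _ _ _ => rfl) ?_ hz,
      volterra_besselKernel_neg lam hF, clamp_of_mem hz]
    intro w hw
    rw [h w hw]
    exact (volterra_congr (fun _ _ _ _ => rfl) hFe hw).symm
  refine ⟨isC2Kernel_besselKernel _, fun x y hx hy => ⟨main lam x y hy, fun h => ?_⟩⟩
  have := main (-lam) y x hx h
  rwa [neg_neg] at this

/-! ### L² estimates -/

lemma sq_integral_mul_le {f g : ℝ → ℝ} {a b : ℝ} (hab : a ≤ b) (hf : Continuous f)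
    (hg : Continuous g) :
    (∫ s in a..b, f s * g s) ^ 2 ≤ (∫ s in a..b, f s ^ 2) * ∫ s in a..b, g s ^ 2 := by
  -- Cauchy–Schwarz by the discriminant of t ↦ ∫ (f + t g)².
  have h : ∀ t : ℝ, 0 ≤ (∫ s in a..b, g s ^ 2) * (t * t) + (2 * ∫ s in a..b, f s * g s) * t +
      ∫ s in a..b, f s ^ 2 := by
    intro t
    have h0 : 0 ≤ ∫ s in a..b, (f s + t * g s) ^ 2 := integral_nonneg hab fun _ _ => sq_nonneg _
    have h1 : ∫ s in a..b, (f s + t * g s) ^ 2 = ∫ s in a..b, ((t * t) * g s ^ 2 +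
        (2 * t) * (f s * g s) + f s ^ 2) := integral_congr fun s _ => by ring
    rw [h1, intervalIntegral.integral_add (Continuous.intervalIntegrable (by fun_prop) _ _)
      (Continuous.intervalIntegrable (by fun_prop) _ _),
      intervalIntegral.integral_add (Continuous.intervalIntegrable (by fun_prop) _ _)
      (Continuous.intervalIntegrable (by fun_prop) _ _), intervalIntegral.integral_const_mul,
      intervalIntegral.integral_const_mul] at h0
    linarith
  have := discrim_le_zero h
  unfold discrim at this
  linarith

lemma l2norm_nonneg (f : ℝ → ℝ) : 0 ≤ l2norm f := sqrt_nonneg _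

lemma kernelNorm_nonneg (κ : ℝ → ℝ → ℝ) : 0 ≤ kernelNorm κ := sqrt_nonneg _

lemma sq_l2norm (f : ℝ → ℝ) : l2norm f ^ 2 = ∫ z in (0 : ℝ)..1, f z ^ 2 :=
  sq_sqrt (integral_nonneg zero_le_one fun _ _ => sq_nonneg _)

lemma l2norm_congr {f g : ℝ → ℝ} (h : EqOn f g (Icc 0 1)) : l2norm f = l2norm g := by
  unfold l2norm
  congr 1
  refine integral_congr fun z hz => ?_
  rw [uIcc_of_le zero_le_one] at hz
  simp only [h hz]

lemma l2norm_add_le {f g : ℝ → ℝ} (hf : Continuous f) (hg : Continuous g) :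
    l2norm (fun z => f z + g z) ≤ l2norm f + l2norm g := by
  refine sqrt_le_iff.2 ⟨add_nonneg (l2norm_nonneg _) (l2norm_nonneg _), ?_⟩
  have hcs := sq_integral_mul_le zero_le_one hf hg
  rw [← sq_l2norm, ← sq_l2norm, ← mul_pow] at hcs
  have hcs' := abs_le_of_sq_le_sq' hcs (mul_nonneg (l2norm_nonneg f) (l2norm_nonneg g))
  have h1 : ∫ z in (0 : ℝ)..1, (f z + g z) ^ 2 = ∫ z in (0 : ℝ)..1, (f z ^ 2 +
      2 * (f z * g z) + g z ^ 2) := integral_congr fun s _ => by ring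
  rw [h1, intervalIntegral.integral_add (Continuous.intervalIntegrable (by fun_prop) _ _)
      (Continuous.intervalIntegrable (by fun_prop) _ _),
      intervalIntegral.integral_add (Continuous.intervalIntegrable (by fun_prop) _ _)
      (Continuous.intervalIntegrable (by fun_prop) _ _), intervalIntegral.integral_const_mul,
      ← sq_l2norm, ← sq_l2norm]
  nlinarith [hcs'.2]

/-- The Volterra transformation is bounded in `L²`. -/
lemma l2norm_volterra_le {κ : ℝ → ℝ → ℝ} (hκ : IsC2Kernel κ) {f : ℝ → ℝ}
    (hf : ContinuousOn f (Icc 0 1)) :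
    l2norm (volterra κ f) ≤ (1 + kernelNorm κ) * l2norm f := by
  obtain ⟨K, K1, K2, hK, -, -, -, -, he⟩ := hκ.exists_extension
  set F : ℝ → ℝ := fun z => f (clamp z) with hFdef
  have hF : Continuous F := hf.comp_continuous continuous_clamp clamp_mem
  have hFe : EqOn F f (Icc 0 1) := fun w hw => by simp only [hFdef, clamp_of_mem hw]
  have hg : Continuous fun z => ∫ s in z..1, K z s * F s :=
    continuous_integral_lower (f := fun z s => K z s * F s) (by fun_prop) continuous_id 1
  have hk2 : Continuous fun z => ∫ s in z..1, K z s ^ 2 :=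
    continuous_integral_lower (f := fun z s => K z s ^ 2) (by
      simp only [Function.uncurry_def] at hK ⊢; fun_prop) continuous_id 1
  have hkn : kernelNorm κ = √(∫ z in (0 : ℝ)..1, ∫ s in z..1, K z s ^ 2) := by
    unfold kernelNorm
    congr 1
    refine integral_congr fun z hz => integral_congr fun s hs => ?_
    rw [uIcc_of_le zero_le_one] at hz
    rw [uIcc_of_le hz.2] at hs
    simp only [he z hz s ⟨hz.1.trans hs.1, hs.2⟩]
  have hkn2 : kernelNorm κ ^ 2 = ∫ z in (0 : ℝ)..1, ∫ s in z..1, K z s ^ 2 := by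
    rw [hkn]
    exact sq_sqrt (integral_nonneg zero_le_one fun z hz =>
      integral_nonneg hz.2 fun _ _ => sq_nonneg _)
  rw [l2norm_congr (g := fun z => F z + ∫ s in z..1, K z s * F s)
    (fun z hz => volterra_congr he hFe hz), ← l2norm_congr hFe]
  refine (l2norm_add_le hF hg).trans ?_
  rw [add_mul, one_mul]
  refine add_le_add le_rfl (sqrt_le_iff.2
    ⟨mul_nonneg (kernelNorm_nonneg _) (l2norm_nonneg _), ?_⟩)
  rw [mul_pow, hkn2, ← intervalIntegral.integral_mul_const]
  refine integral_mono_on zero_le_one (Continuous.intervalIntegrable (by fun_prop) _ _)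
    (Continuous.intervalIntegrable (by fun_prop) _ _) fun z hz => ?_
  have cKz : Continuous (K z) := by fun_prop
  -- Cauchy–Schwarz in s for fixed z; the integral of F² over [z,1] is then enlarged to [0,1].
  refine (sq_integral_mul_le hz.2 cKz hF).trans ?_
  refine mul_le_mul_of_nonneg_left ?_ (integral_nonneg hz.2 fun _ _ => sq_nonneg _)
  rw [sq_l2norm]
  exact integral_mono_interval hz.1 hz.2 le_rfl (Eventually.of_forall fun _ => sq_nonneg _)
    (Continuous.intervalIntegrable (by fun_prop) _ _)

/-! ### Modes of the transformed trajectory: uniqueness and the estimate -/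

/-- Comparison estimate for a forced linear scalar equation. -/
lemma abs_le_of_linear_ode {a d : ℝ → ℝ} {lam β M T : ℝ} (hT : 0 ≤ T) (hlam : 0 < lam)
    (hβ : 0 ≤ β) (hc : ContinuousOn a (Icc 0 T))
    (hd : ∀ t ∈ Ioo 0 T, HasDerivAt a (-lam * a t + β * d t) t)
    (hM : ∀ t ∈ Icc 0 T, |d t| ≤ M) :
    |a T| ≤ exp (-lam * T) * |a 0| + β * M / lam := by
  have hexp : ∀ t, HasDerivAt (fun t => exp (lam * t)) (lam * exp (lam * t)) t := fun t => by
    have : HasDerivAt (fun t => lam * t) lam t := by simpa using (hasDerivAt_id t).const_mul lam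
    exact this.exp.congr_deriv (by ring)
  have key : ∀ σ : ℝ, |σ| = 1 → σ * a T ≤ exp (-lam * T) * |a 0| + β * M / lam := by
    intro σ hσ
    -- The derivative is e^(lam t) β (M - σ d) ≥ 0; comparing the values at 0 and T bounds σ a(T).
    -- The signs σ = ±1 give both halves of the absolute value.
    have hmono : MonotoneOn (fun t => β * M / lam * exp (lam * t) - σ * (exp (lam * t) * a t))
        (Icc 0 T) := by
      refine monotoneOn_of_hasDerivWithinAt_nonneg (convex_Icc 0 T)
        (f' := fun t => exp (lam * t) * (β * (M - σ * d t))) ?_ ?_ ?_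
      · exact ContinuousOn.sub (by fun_prop) (continuousOn_const.mul
          (ContinuousOn.mul (by fun_prop) hc))
      · intro t ht
        rw [interior_Icc] at ht
        refine HasDerivAt.hasDerivWithinAt ?_
        refine (((hexp t).const_mul (β * M / lam)).sub
          (((hexp t).mul (hd t ht)).const_mul σ)).congr_deriv ?_
        field_simp
        ring
      · intro t ht
        rw [interior_Icc] at ht
        have h1 : σ * d t ≤ M := by
          calc σ * d t ≤ |σ * d t| := le_abs_self _
            _ = |d t| := by rw [abs_mul, hσ, one_mul]
            _ ≤ M := hM t (Ioo_subset_Icc_self ht)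
        exact mul_nonneg (exp_pos _).le (mul_nonneg hβ (by linarith))
    have h := hmono (left_mem_Icc.2 hT) (right_mem_Icc.2 hT) hT
    simp only [mul_zero, exp_zero, one_mul, mul_one] at h
    have hM0 : 0 ≤ M := (abs_nonneg _).trans (hM 0 (left_mem_Icc.2 hT))
    have h0 : σ * a 0 ≤ |a 0| := by
      calc σ * a 0 ≤ |σ * a 0| := le_abs_self _
        _ = |a 0| := by rw [abs_mul, hσ, one_mul]
    have hB : 0 ≤ β * M / lam := by positivity
    have hE : exp (-lam * T) * exp (lam * T) = 1 := by rw [← exp_add]; simp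
    have hE0 := exp_pos (-lam * T)
    have h2 : exp (lam * T) * (σ * a T) ≤ β * M / lam * exp (lam * T) + |a 0| := by linarith
    have h3 := mul_le_mul_of_nonneg_left h2 hE0.le
    calc σ * a T = (exp (-lam * T) * exp (lam * T)) * (σ * a T) := by rw [hE, one_mul]
      _ ≤ exp (-lam * T) * (β * M / lam * exp (lam * T) + |a 0|) := by linarith
      _ = exp (-lam * T) * |a 0| + β * M / lam * (exp (-lam * T) * exp (lam * T)) := by ring
      _ = _ := by rw [hE, mul_one]
  rw [abs_le']
  exact ⟨by simpa using key 1 (by simp), by simpa using key (-1) (by simp)⟩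

section Coefficients

variable {D p c : ℝ} {k : ℝ → ℝ → ℝ} {d y₀ : ℝ → ℝ} {y : ℝ → ℝ → ℝ}

/-- The feedback integral cancels against T_k at z = 0, leaving the disturbance as Dirichlet datum.
-/
lemma IsClosedLoopSolution.volterra_left (hy : IsClosedLoopSolution D p k d y₀ y) {t : ℝ}
    (ht : 0 ≤ t) : volterra k (y t) 0 = d t := by
  rw [volterra, hy.left t ht]; ring

lemma IsClosedLoopSolution.volterra_right (hy : IsClosedLoopSolution D p k d y₀ y) {t : ℝ}
    (ht : 0 ≤ t) : volterra k (y t) 1 = 0 := by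
  rw [volterra, hy.right t ht]; simp

lemma IsClosedLoopSolution.continuousOn_sineCoeff (hk : IsC2Kernel k)
    (hy : IsClosedLoopSolution D p k d y₀ y) (n : ℕ) :
    ContinuousOn (fun t => sineCoeff (volterra k (y t)) n) (Ici 0) := by
  obtain ⟨K, K1, K2, hK, -, -, -, -, he⟩ := hk.exists_extension
  have hY : ContinuousOn (Function.uncurry fun t s => y t (clamp s)) (Ici 0 ×ˢ univ) :=
    hy.continuousOn.comp (f := fun q : ℝ × ℝ => (q.1, clamp q.2))
      (continuous_fst.prodMk (continuous_clamp.comp continuous_snd)).continuousOn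
      fun q hq => ⟨hq.1, clamp_mem _⟩
  have hX := hY.add (continuousOn_integral_kernel hY hK)
  have hXs : ContinuousOn (Function.uncurry fun t z => (y t (clamp z) +
      ∫ s in z..1, K z s * y t (clamp s)) * sin (freq n * z)) (Ici 0 ×ˢ univ) :=
    hX.mul (by fun_prop)
  refine (continuousOn_integral_param hXs 0 1).congr fun t _ => ?_
  refine integral_congr fun z hz => ?_
  rw [uIcc_of_le zero_le_one] at hz
  rw [volterra_congr (F := fun z => y t (clamp z)) he
    (fun w hw => by simp only [clamp_of_mem hw]) hz, volterra]

/-- The sine coefficients of the transformed trajectory solve scalar linear equations. -/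
lemma IsClosedLoopSolution.hasDerivAt_sineCoeff (hk : IsBacksteppingKernel D p c k)
    (hy : IsClosedLoopSolution D p k d y₀ y) (n : ℕ) {t : ℝ} (ht : 0 < t) :
    HasDerivAt (fun t => sineCoeff (volterra k (y t)) n)
      (-(c + D * freq n ^ 2) * sineCoeff (volterra k (y t)) n + D * freq n * d t) t := by
  obtain ⟨K, K1, K2, hK, -, -, -, -, he⟩ := hk.1.exists_extension
  set Q : Set (ℝ × ℝ) := Ioi 0 ×ˢ Icc 0 1 with hQ
  have hu : UniqueDiffOn ℝ Q := isOpen_Ioi.uniqueDiffOn.prod (uniqueDiffOn_Icc zero_lt_one)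
  set φ : ℝ × ℝ → ℝ := fun q => y q.1 q.2 with hφ
  have hφ1 : ContDiffOn ℝ 1 φ Q := hy.contDiffOn
  set Y : ℝ → ℝ → ℝ := fun t s => y t (clamp s) with hYdef
  -- Reading the time derivative off the Fréchet derivative within the closed strip makes it
  -- continuous up to z = 0 and z = 1.
  set Yt : ℝ → ℝ → ℝ := fun t s => fderivWithin ℝ φ Q (t, clamp s) (1, 0) with hYtdef
  have hcl : ContinuousOn (fun q : ℝ × ℝ => (q.1, clamp q.2)) (Ioi 0 ×ˢ univ) :=
    (continuous_fst.prodMk (continuous_clamp.comp continuous_snd)).continuousOn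
  have hY : ContinuousOn (Function.uncurry Y) (Ioi 0 ×ˢ univ) :=
    hφ1.continuousOn.comp hcl fun q hq => ⟨hq.1, clamp_mem _⟩
  have hYt : ContinuousOn (Function.uncurry Yt) (Ioi 0 ×ˢ univ) := by
    have h1 : ContinuousOn (fun q => fderivWithin ℝ φ Q q (1, 0)) Q :=
      (hφ1.continuousOn_fderivWithin hu (by norm_num)).clm_apply continuousOn_const
    exact h1.comp hcl fun q hq => ⟨hq.1, clamp_mem _⟩
  have hYd : ∀ t ∈ Ioi (0 : ℝ), ∀ s, HasDerivAt (fun t => Y t s) (Yt t s) t := by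
    intro t ht s
    have hm : (t, clamp s) ∈ Q := ⟨ht, clamp_mem s⟩
    have h1 := (hφ1.differentiableOn (by norm_num) _ hm).hasFDerivWithinAt
    have h2 : HasDerivWithinAt (fun t : ℝ => (t, clamp s)) ((1 : ℝ), (0 : ℝ)) (Ioi 0) t :=
      ((hasDerivAt_id t).prodMk (hasDerivAt_const t (clamp s))).hasDerivWithinAt
    have hmaps : MapsTo (fun t : ℝ => (t, clamp s)) (Ioi 0) Q := fun w hw => ⟨hw, clamp_mem s⟩
    exact (h1.comp_hasDerivWithinAt t h2 hmaps).hasDerivAt (isOpen_Ioi.mem_nhds ht)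
  have sliceY : ∀ t ∈ Ioi (0 : ℝ), Continuous (Y t) := fun t ht =>
    hY.comp_continuous (f := fun s => (t, s)) (by fun_prop) fun s => ⟨ht, mem_univ _⟩
  -- the transformed trajectory and its time derivative
  have hXd : ∀ t ∈ Ioi (0 : ℝ), ∀ z, HasDerivAt (fun t => volterra K (Y t) z)
      (volterra K (Yt t) z) t := by
    intro t ht z
    have cKz : Continuous (K z) := by fun_prop
    refine (hYd t ht z).add (hasDerivAt_integral_param (f := fun t s => K z s * Y t s)
      (f' := fun t s => K z s * Yt t s) isOpen_Ioi (fun t ht => ?_) ?_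
      (fun t ht s _ => (hYd t ht s).const_mul _) ht)
    · have := sliceY t ht
      fun_prop
    · exact ContinuousOn.mul (by fun_prop) (hYt.mono (prod_mono Subset.rfl (subset_univ _)))
  have hX : ContinuousOn (Function.uncurry fun t z => volterra K (Y t) z) (Ioi 0 ×ˢ univ) :=
    hY.add (continuousOn_integral_kernel hY hK)
  have hXt : ContinuousOn (Function.uncurry fun t z => volterra K (Yt t) z) (Ioi 0 ×ˢ univ) :=
    hYt.add (continuousOn_integral_kernel hYt hK)
  have main := hasDerivAt_integral_param (a := 0) (b := 1)
    (f := fun t z => volterra K (Y t) z * sin (freq n * z))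
    (f' := fun t z => volterra K (Yt t) z * sin (freq n * z)) isOpen_Ioi
    (fun t ht => by
      have := continuous_volterra hK (sliceY t ht)
      fun_prop)
    (ContinuousOn.mul (hXt.mono (prod_mono Subset.rfl (subset_univ _))) (by fun_prop))
    (fun t ht z _ => (hXd t ht z).mul_const _) ht
  have hYe : ∀ t, EqOn (Y t) (y t) (Icc 0 1) := fun t w hw => by
    simp only [hYdef, clamp_of_mem hw]
  have hvol : ∀ t, ∀ z ∈ Icc (0 : ℝ) 1, volterra k (y t) z = volterra K (Y t) z := fun t z hz =>
    volterra_congr he (hYe t) hz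
  have hsc : ∀ t, sineCoeff (volterra k (y t)) n =
      ∫ z in (0 : ℝ)..1, volterra K (Y t) z * sin (freq n * z) := fun t =>
    sineCoeff_congr (fun z hz => hvol t z hz) n
  simp only [hsc]
  refine main.congr_deriv ?_
  rw [← hsc t]
  obtain ⟨W, W1, W2, hW, hWe⟩ := exists_C2Data_Icc (contDiffOn_volterra hk.1 (hy.profile t ht.le))
  -- ∂_t commutes with T_k, so x_t = T_k(D y'' + p y) by the equation for y, and this is D x'' - c x
  -- by the backstepping property.
  have hder : ∀ z ∈ Ioo (0 : ℝ) 1, volterra K (Yt t) z = D * W2 z - c * W z := by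
    intro z hz
    have hzI := Ioo_subset_Icc_self hz
    have h1 := hk.2 (y t) (hy.profile t ht.le) (hy.right t ht.le) z hz
    rw [hW.deriv2 isOpen_Ioo (fun r hr => (hWe (Ioo_subset_Icc_self hr)).symm) hz,
      ← hWe hzI] at h1
    rw [h1]
    have hpt : ∀ s ∈ Ioo (0 : ℝ) 1, Yt t s = D * deriv (deriv (y t)) s + p * y t s := by
      intro s hs
      rw [← hy.pde t ht s hs, ← (hYd t ht s).deriv]
      simp only [hYdef, clamp_of_mem (Ioo_subset_Icc_self hs)]
    unfold volterra
    beta_reduce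
    rw [hpt z hz]
    congr 1
    rw [integral_of_le hz.2.le, integral_of_le hz.2.le, integral_Ioc_eq_integral_Ioo,
      integral_Ioc_eq_integral_Ioo]
    refine setIntegral_congr_fun measurableSet_Ioo fun s hs => ?_
    have hs' : s ∈ Ioo (0 : ℝ) 1 := ⟨hz.1.trans hs.1, hs.2⟩
    simp only [hpt s hs', he z hzI s (Ioo_subset_Icc_self hs')]
  have hint : ∫ z in (0 : ℝ)..1, volterra K (Yt t) z * sin (freq n * z) =
      D * sineCoeff W2 n - c * sineCoeff W n := by
    have c1 := hW.cont
    have c2 := hW.cont2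
    unfold sineCoeff
    rw [← intervalIntegral.integral_const_mul, ← intervalIntegral.integral_const_mul,
      ← intervalIntegral.integral_sub (Continuous.intervalIntegrable (by fun_prop) _ _)
      (Continuous.intervalIntegrable (by fun_prop) _ _), integral_of_le zero_le_one,
      integral_of_le zero_le_one, integral_Ioc_eq_integral_Ioo, integral_Ioc_eq_integral_Ioo]
    refine setIntegral_congr_fun measurableSet_Ioo fun z hz => ?_
    simp only [hder z hz]; ring
  rw [hint, hW.sineCoeff_deriv2, ← sineCoeff_congr hWe n, hWe ⟨le_rfl, zero_le_one⟩,
    hWe ⟨zero_le_one, le_rfl⟩, hy.volterra_left ht.le, hy.volterra_right ht.le]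
  ring

/-- Solutions are unique. -/
lemma IsClosedLoopSolution.unique {l : ℝ → ℝ → ℝ} (hD : 0 < D) (hc : 0 ≤ c)
    (hk : IsBacksteppingKernel D p c k) (hl : IsInverseKernel k l) {y' : ℝ → ℝ → ℝ}
    (hy : IsClosedLoopSolution D p k d y₀ y) (hy' : IsClosedLoopSolution D p k d y₀ y') {t : ℝ}
    (ht : 0 ≤ t) : EqOn (y' t) (y t) (Icc 0 1) := by
  have hcoef : ∀ n, sineCoeff (volterra k (y' t)) n = sineCoeff (volterra k (y t)) n := by
    intro n
    have hf := freq_pos n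
    -- The disturbance cancels in the difference, so the comparison applies with zero forcing.
    have h := abs_le_of_linear_ode (a := fun t => sineCoeff (volterra k (y' t)) n -
      sineCoeff (volterra k (y t)) n) (d := fun _ => 0) (lam := c + D * freq n ^ 2) (β := 0) (M := 0)
      ht (by positivity) le_rfl
      (((hy'.continuousOn_sineCoeff hk.1 n).sub (hy.continuousOn_sineCoeff hk.1 n)).mono
        Icc_subset_Ici_self)
      (fun τ hτ => ((hy'.hasDerivAt_sineCoeff hk n hτ.1).sub
        (hy.hasDerivAt_sineCoeff hk n hτ.1)).congr_deriv (by ring)) (by simp)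
    have h0 : sineCoeff (volterra k (y' 0)) n = sineCoeff (volterra k (y 0)) n :=
      sineCoeff_congr (fun z hz => volterra_congr (fun _ _ _ _ => rfl)
        (fun w hw => by rw [hy.initial w hw, hy'.initial w hw]) hz) n
    rw [h0] at h
    simp only [sub_self, abs_zero, mul_zero, zero_div, add_zero] at h
    exact sub_eq_zero.1 (abs_nonpos_iff.1 h)
  have hcy := (hy.profile t ht).continuousOn
  have hcy' := (hy'.profile t ht).continuousOn
  have hx := eqOn_of_sineCoeff_eq (continuousOn_volterra hk.1 hcy')
    (continuousOn_volterra hk.1 hcy) hcoef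
  -- Both profiles are T_l of the same function T_k y.
  have h1 := (hl.2 _ _ (continuousOn_volterra hk.1 hcy) hcy).1 fun _ _ => rfl
  have h2 := (hl.2 _ _ (continuousOn_volterra hk.1 hcy) hcy').1 fun z hz => (hx hz).symm
  intro z hz
  rw [h1 z hz, h2 z hz]

/-- D freq/(c + D freq²) is the static gain of the n-th mode: input coefficient over decay rate, as
it appears in `abs_le_of_linear_ode`. Comparison with Σ 1/n² shows that the series defining `gain`
converges. -/
lemma hasSum_gain_sq (hD : 0 < D) (hc : 0 ≤ c) :
    HasSum (fun n => 2 * (D * freq n / (c + D * freq n ^ 2)) ^ 2) (gain D c ^ 2) := by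
  have hpi := pi_pos
  have hsum : Summable fun n : ℕ =>
      ((n : ℝ) + 1) ^ 2 / (√(c / D) ^ 2 / π ^ 2 + ((n : ℝ) + 1) ^ 2) ^ 2 := by
    have h2 := (summable_nat_add_iff 1).2 (Real.summable_one_div_nat_pow.2 one_lt_two)
    refine h2.of_nonneg_of_le (fun n => by positivity) fun n => ?_
    have hn : (0 : ℝ) < (n : ℝ) + 1 := by positivity
    push_cast
    rw [div_le_div_iff₀ (by positivity) (by positivity), one_mul, ← mul_pow, sq]
    have : ((n : ℝ) + 1) * (n + 1) ≤ √(c / D) ^ 2 / π ^ 2 + ((n : ℝ) + 1) ^ 2 := by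
      have : 0 ≤ √(c / D) ^ 2 / π ^ 2 := by positivity
      nlinarith
    nlinarith [mul_pos hn hn]
  have hg : gain D c ^ 2 = 2 / π ^ 2 * ∑' n : ℕ,
      ((n : ℝ) + 1) ^ 2 / (√(c / D) ^ 2 / π ^ 2 + ((n : ℝ) + 1) ^ 2) ^ 2 := by
    rw [gain, mul_pow, div_pow, sq_sqrt zero_le_two,
      sq_sqrt (tsum_nonneg fun n => by positivity)]
  rw [hg]
  convert! hsum.hasSum.mul_left (2 / π ^ 2) using 1
  funext n
  have hn : (0 : ℝ) < (n : ℝ) + 1 := by positivity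
  rw [sq_sqrt (by positivity), ← div_pow]
  have e : c / D / π ^ 2 + ((n : ℝ) + 1) ^ 2 = (c + D * freq n ^ 2) / (D * π ^ 2) := by
    unfold freq; field_simp
  have hden : 0 < c + D * freq n ^ 2 := by have := freq_pos n; positivity
  rw [e]
  rw [show freq n = ((n : ℝ) + 1) * π from rfl] at *
  field_simp

/-- The estimate in the transformed variable. -/
lemma IsClosedLoopSolution.l2norm_volterra_le (hD : 0 < D) (hc : 0 ≤ c)
    (hk : IsBacksteppingKernel D p c k) (hy : IsClosedLoopSolution D p k d y₀ y) {t ε M : ℝ}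
    (ht : 0 ≤ t) (hε : 0 < ε) (hM : ∀ s ∈ Icc 0 t, |d s| ≤ M) :
    l2norm (volterra k (y t)) ≤ exp (-(c + D * π ^ 2) * t) * l2norm (volterra k (y 0)) * √(1 + ε) +
      √(1 + ε⁻¹) * gain D c * M := by
  have hM0 : 0 ≤ M := (abs_nonneg _).trans (hM 0 (left_mem_Icc.2 ht))
  set E := exp (-(c + D * π ^ 2) * t)
  have hE : 0 < E := exp_pos _
  have hG : 0 ≤ gain D c := by unfold gain; positivity
  have hP := fun τ (hτ : 0 ≤ τ) => hasSum_sq_sineCoeff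
    (continuousOn_volterra hk.1 (hy.profile τ hτ).continuousOn)
  have hterm : ∀ n, 2 * sineCoeff (volterra k (y t)) n ^ 2 ≤
      (1 + ε) * E ^ 2 * (2 * sineCoeff (volterra k (y 0)) n ^ 2) +
      (1 + ε⁻¹) * M ^ 2 * (2 * (D * freq n / (c + D * freq n ^ 2)) ^ 2) := by
    intro n
    have hf := freq_pos n
    have h := abs_le_of_linear_ode ht (by positivity) (by positivity : 0 ≤ D * freq n)
      ((hy.continuousOn_sineCoeff hk.1 n).mono Icc_subset_Ici_self)
      (fun τ hτ => hy.hasDerivAt_sineCoeff hk n hτ.1) hM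
    have hexp : exp (-(c + D * freq n ^ 2) * t) ≤ E := by
      refine exp_le_exp.2 (mul_le_mul_of_nonneg_right ?_ ht)
      have := pow_le_pow_left₀ pi_pos.le (pi_le_freq n) 2
      nlinarith
    set A := |sineCoeff (volterra k (y 0)) n|
    set B := D * freq n / (c + D * freq n ^ 2)
    have hB : D * freq n * M / (c + D * freq n ^ 2) = M * B := by simp only [B]; ring
    rw [hB] at h
    have h' : |sineCoeff (volterra k (y t)) n| ≤ E * A + M * B :=
      h.trans (add_le_add (mul_le_mul_of_nonneg_right hexp (abs_nonneg _)) le_rfl)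
    have hsq : sineCoeff (volterra k (y t)) n ^ 2 ≤ (E * A + M * B) ^ 2 := by
      rw [← sq_abs]; exact pow_le_pow_left₀ (abs_nonneg _) h' 2
    have hA : A ^ 2 = sineCoeff (volterra k (y 0)) n ^ 2 := sq_abs _
    -- This yields (EA + MB)² ≤ (1+ε)(EA)² + (1+ε⁻¹)(MB)², the source of the two square roots in the
    -- estimate.
    have young : 2 * ((E * A) * (M * B)) ≤ ε * (E * A) ^ 2 + ε⁻¹ * (M * B) ^ 2 := by
      have h1 : 0 ≤ ε⁻¹ * (ε * (E * A) - M * B) ^ 2 := by positivity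
      have h2 : ε⁻¹ * (ε * (E * A) - M * B) ^ 2 =
          ε * (E * A) ^ 2 + ε⁻¹ * (M * B) ^ 2 - 2 * ((E * A) * (M * B)) := by
        field_simp; ring
      linarith
    rw [← hA]
    nlinarith
  have hsum := hasSum_le hterm (hP t ht)
    (((hP 0 le_rfl).mul_left ((1 + ε) * E ^ 2)).add
      ((hasSum_gain_sq hD hc).mul_left ((1 + ε⁻¹) * M ^ 2)))
  rw [← sq_l2norm, ← sq_l2norm] at hsum
  have hN := l2norm_nonneg (volterra k (y 0))
  refine abs_le_of_sq_le_sq' (hsum.trans ?_) (by positivity) |>.2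
  have e1 : √(1 + ε) ^ 2 = 1 + ε := sq_sqrt (by positivity)
  have e2 : √(1 + ε⁻¹) ^ 2 = 1 + ε⁻¹ := sq_sqrt (by positivity)
  have hcross : 0 ≤ (E * l2norm (volterra k (y 0)) * √(1 + ε)) * (√(1 + ε⁻¹) * gain D c * M) := by
    positivity
  -- Summation over the modes gave a bound X² + Y² for the squared norm; it is at most (X + Y)².
  calc _ = (E * l2norm (volterra k (y 0)) * √(1 + ε)) ^ 2 + (√(1 + ε⁻¹) * gain D c * M) ^ 2 := by
        rw [mul_pow _ (√(1 + ε)), mul_pow (√(1 + ε⁻¹) * gain D c), mul_pow (√(1 + ε⁻¹)), e1, e2]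
        ring
    _ ≤ _ := by nlinarith

/-- The estimate in the original variable. -/
lemma IsClosedLoopSolution.l2norm_le {l : ℝ → ℝ → ℝ} (hD : 0 < D) (hc : 0 ≤ c)
    (hk : IsBacksteppingKernel D p c k) (hl : IsInverseKernel k l)
    (hd : ContinuousOn d (Ici 0)) (hy : IsClosedLoopSolution D p k d y₀ y) {t ε : ℝ}
    (ht : 0 ≤ t) (hε : 0 < ε) :
    l2norm (y t) ≤ exp (-(c + D * π ^ 2) * t) * (1 + kernelNorm l) *
        (1 + kernelNorm k) * l2norm y₀ * √(1 + ε) +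
      (1 + kernelNorm l) * √(1 + ε⁻¹) * gain D c * sSup ((fun s => |d s|) '' Icc 0 t) := by
  set M := sSup ((fun s => |d s|) '' Icc 0 t)
  have hbdd : BddAbove ((fun s => |d s|) '' Icc 0 t) :=
    isCompact_Icc.bddAbove_image (hd.mono Icc_subset_Ici_self).abs
  have hM : ∀ s ∈ Icc 0 t, |d s| ≤ M := fun s hs => le_csSup hbdd (mem_image_of_mem _ hs)
  have hcy := (hy.profile t ht).continuousOn
  have hcy0 := (hy.profile 0 le_rfl).continuousOn
  have hinv := (hl.2 _ _ (continuousOn_volterra hk.1 hcy) hcy).1 fun _ _ => rfl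
  have h1 : l2norm (y t) ≤ (1 + kernelNorm l) * l2norm (volterra k (y t)) := by
    rw [l2norm_congr hinv]
    exact BoundaryISS.l2norm_volterra_le hl.1 (continuousOn_volterra hk.1 hcy)
  have h2 := hy.l2norm_volterra_le hD hc hk ht hε hM
  have h3 : l2norm (volterra k (y 0)) ≤ (1 + kernelNorm k) * l2norm y₀ := by
    rw [← l2norm_congr hy.initial]
    exact BoundaryISS.l2norm_volterra_le hk.1 hcy0
  have hl0 := kernelNorm_nonneg l
  calc l2norm (y t) ≤ (1 + kernelNorm l) * l2norm (volterra k (y t)) := h1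
    _ ≤ (1 + kernelNorm l) * (exp (-(c + D * π ^ 2) * t) * ((1 + kernelNorm k) * l2norm y₀) *
        √(1 + ε) + √(1 + ε⁻¹) * gain D c * M) := by
      refine mul_le_mul_of_nonneg_left (h2.trans (add_le_add ?_ le_rfl)) (by positivity)
      gcongr
    _ = _ := by ring

end Coefficients

/-! ### Solution of the target heat equation by sine series -/

/-- The response of a scalar mode with decay rate `lam` to the forcing `h`. -/
noncomputable def duhamel (h : ℝ → ℝ) (lam t : ℝ) : ℝ :=
  exp (-lam * t) * ∫ s in (0 : ℝ)..t, exp (lam * s) * h s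

lemma hasDerivAt_duhamel {h : ℝ → ℝ} (hh : Continuous h) (lam t : ℝ) :
    HasDerivAt (duhamel h lam) (-lam * duhamel h lam t + h t) t := by
  have h1 : HasDerivAt (fun t => exp (-lam * t)) (exp (-lam * t) * -lam) t := by
    have : HasDerivAt (fun t => -lam * t) (-lam) t := by
      simpa using (hasDerivAt_id t).const_mul (-lam)
    exact this.exp
  have hc : Continuous fun s => exp (lam * s) * h s := by fun_prop
  have h2 : HasDerivAt (fun t => ∫ s in (0 : ℝ)..t, exp (lam * s) * h s) (exp (lam * t) * h t) t :=
    integral_hasDerivAt_right (hc.intervalIntegrable _ _) (hc.stronglyMeasurableAtFilter _ _)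
      hc.continuousAt
  refine (h1.mul h2).congr_deriv ?_
  have hE : exp (-lam * t) * exp (lam * t) = 1 := by rw [← exp_add]; simp
  unfold duhamel
  linear_combination h t * hE

lemma continuous_duhamel {h : ℝ → ℝ} (hh : Continuous h) (lam : ℝ) : Continuous (duhamel h lam) :=
  continuous_iff_continuousAt.2 fun t => (hasDerivAt_duhamel hh lam t).continuousAt

lemma abs_duhamel_le {h : ℝ → ℝ} (hh : Continuous h) {lam M T : ℝ} (hlam : 0 < lam)
    (hM : ∀ t ∈ Icc 0 T, |h t| ≤ M) (hT : 0 ≤ T) : |duhamel h lam T| ≤ M / lam := by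
  have := abs_le_of_linear_ode (a := duhamel h lam) (d := h) (β := 1) hT hlam zero_le_one
    (continuous_duhamel hh lam).continuousOn
    (fun t _ => (hasDerivAt_duhamel hh lam t).congr_deriv (by ring)) hM
  simpa [duhamel] using this

/-- The modes of the forced heat equation. -/
noncomputable def heatMode (h : ℝ → ℝ) (lam b e t : ℝ) : ℝ := exp (-lam * t) * b - e * duhamel h lam t

lemma hasDerivAt_heatMode {h : ℝ → ℝ} (hh : Continuous h) (lam b e t : ℝ) :
    HasDerivAt (heatMode h lam b e) (-lam * heatMode h lam b e t - e * h t) t := by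
  have h1 : HasDerivAt (fun t => exp (-lam * t)) (exp (-lam * t) * -lam) t := by
    have : HasDerivAt (fun t => -lam * t) (-lam) t := by
      simpa using (hasDerivAt_id t).const_mul (-lam)
    exact this.exp
  refine ((h1.mul_const b).sub ((hasDerivAt_duhamel hh lam t).const_mul e)).congr_deriv ?_
  unfold heatMode; ring

lemma continuous_heatMode {h : ℝ → ℝ} (hh : Continuous h) (lam b e : ℝ) :
    Continuous (heatMode h lam b e) :=
  continuous_iff_continuousAt.2 fun t => (hasDerivAt_heatMode hh lam b e t).continuousAt

/-- The initial part decays exponentially and the forced part gains a factor 1/lam. Hence lam times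
the mode is summable for t > 0 as soon as the b and e are. -/
lemma abs_heatMode_le {h : ℝ → ℝ} (hh : Continuous h) {lam M T b e t : ℝ} (hlam : 0 < lam)
    (hM : ∀ t ∈ Icc 0 T, |h t| ≤ M) (ht : t ∈ Icc 0 T) :
    |heatMode h lam b e t| ≤ exp (-lam * t) * |b| + |e| * (M / lam) := by
  have := abs_duhamel_le hh hlam (fun s hs => hM s ⟨hs.1, hs.2.trans ht.2⟩) ht.1
  refine (abs_sub _ _).trans ?_
  rw [abs_mul, abs_mul, abs_of_pos (exp_pos _)]
  gcongr

/-- Local uniform summability of a series of functions of time, on positive times. -/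
def LocallySummable (g : ℕ → ℝ → ℝ) : Prop :=
  ∀ T : ℝ, 0 < T → ∃ u : ℕ → ℝ, Summable u ∧ ∀ n, ∀ t ∈ Ioo (T / 2) (T + 1), |g n t| ≤ u n

lemma LocallySummable.of_abs_le {g g' : ℕ → ℝ → ℝ} (hg : LocallySummable g) (C : ℝ) (hC : 0 ≤ C)
    (h : ∀ n t, |g' n t| ≤ C * |g n t|) : LocallySummable g' := fun T hT => by
  obtain ⟨u, hu, hgu⟩ := hg T hT
  exact ⟨fun n => C * u n, hu.mul_left C, fun n t ht =>
    (h n t).trans (mul_le_mul_of_nonneg_left (hgu n t ht) hC)⟩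

lemma LocallySummable.add {g g' : ℕ → ℝ → ℝ} (hg : LocallySummable g) (hg' : LocallySummable g') :
    LocallySummable fun n t => g n t + g' n t := fun T hT => by
  obtain ⟨u, hu, hgu⟩ := hg T hT
  obtain ⟨u', hu', hgu'⟩ := hg' T hT
  exact ⟨fun n => u n + u' n, hu.add hu', fun n t ht =>
    (abs_add_le _ _).trans (add_le_add (hgu n t ht) (hgu' n t ht))⟩

lemma LocallySummable.summable {g : ℕ → ℝ → ℝ} (hg : LocallySummable g) {t : ℝ} (ht : 0 < t) :
    Summable fun n => |g n t| := by
  obtain ⟨u, hu, hgu⟩ := hg t ht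
  exact hu.of_nonneg_of_le (fun _ => abs_nonneg _) fun n => hgu n t ⟨by linarith, by linarith⟩

lemma summable_mul_of_abs_le_one {a φ : ℕ → ℝ} (ha : Summable fun n => |a n|)
    (hφ : ∀ n, |φ n| ≤ 1) : Summable fun n => a n * φ n :=
  Summable.of_norm_bounded ha fun n => by
    rw [norm_mul]; exact mul_le_of_le_one_right (abs_nonneg _) (hφ n)

/-- Stated for a general time set A: for x itself A contains t = 0, for its derivatives A is the set
of positive times. -/
lemma continuousOn_series {A : Set ℝ} {g φ : ℕ → ℝ → ℝ} (hg : ∀ n, Continuous (g n))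
    (hφ : ∀ n, Continuous (φ n)) (hφ1 : ∀ n z, |φ n z| ≤ 1)
    (hb : ∀ T ∈ A, ∃ N, IsOpen N ∧ T ∈ N ∧ ∃ u : ℕ → ℝ, Summable u ∧
      ∀ n, ∀ t ∈ A ∩ N, |g n t| ≤ u n) :
    ContinuousOn (Function.uncurry fun t z => ∑' n, g n t * φ n z) (A ×ˢ univ) := by
  refine continuousOn_of_locally_continuousOn fun q hq => ?_
  obtain ⟨N, hN, hTN, u, hu, hgu⟩ := hb q.1 hq.1
  refine ⟨N ×ˢ univ, hN.prod isOpen_univ, ⟨hTN, mem_univ _⟩, ?_⟩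
  refine continuousOn_tsum (f := fun n (q : ℝ × ℝ) => g n q.1 * φ n q.2)
    (fun n => Continuous.continuousOn (by fun_prop)) hu fun n r hr => ?_
  rw [norm_mul]
  exact (mul_le_of_le_one_right (abs_nonneg _) (hφ1 n _)).trans (hgu n _ ⟨hr.1.1, hr.2.1⟩)

lemma LocallySummable.continuousOn_series {g φ : ℕ → ℝ → ℝ} (hl : LocallySummable g)
    (hg : ∀ n, Continuous (g n)) (hφ : ∀ n, Continuous (φ n)) (hφ1 : ∀ n z, |φ n z| ≤ 1) :
    ContinuousOn (Function.uncurry fun t z => ∑' n, g n t * φ n z) (Ioi 0 ×ˢ univ) := by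
  refine BoundaryISS.continuousOn_series hg hφ hφ1 fun T hT => ?_
  have hT' : 0 < T := hT
  obtain ⟨u, hu, hgu⟩ := hl T hT
  exact ⟨Ioo (T / 2) (T + 1), isOpen_Ioo, ⟨by linarith, by linarith⟩, u, hu,
    fun n t ht => hgu n t ht.2⟩

lemma LocallySummable.hasDerivAt_time {g g' φ : ℕ → ℝ → ℝ} (hl : LocallySummable g)
    (hl' : LocallySummable g') (hd : ∀ n t, HasDerivAt (g n) (g' n t) t)
    (hφ1 : ∀ n z, |φ n z| ≤ 1) {t : ℝ} (ht : 0 < t) (z : ℝ) :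
    HasDerivAt (fun t => ∑' n, g n t * φ n z) (∑' n, g' n t * φ n z) t := by
  obtain ⟨u, hu, hgu⟩ := hl' t ht
  have hm : t ∈ Ioo (t / 2) (t + 1) := ⟨by linarith, by linarith⟩
  refine hasDerivAt_tsum_of_isPreconnected (g := fun n t => g n t * φ n z)
    (g' := fun n t => g' n t * φ n z) hu isOpen_Ioo isPreconnected_Ioo
    (fun n s _ => (hd n s).mul_const _) (fun n s hs => ?_) hm
    (summable_mul_of_abs_le_one (hl.summable ht) fun n => hφ1 n z) hm
  rw [norm_mul]
  exact (mul_le_of_le_one_right (abs_nonneg _) (hφ1 n _)).trans (hgu n _ hs)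

/-- Applied twice: from sine to cosine with r = freq, then from cosine to sine with r = -freq. -/
lemma hasDerivAt_series_space {a r : ℕ → ℝ} {φ ψ : ℕ → ℝ → ℝ} (ha : Summable fun n => |a n|)
    (har : Summable fun n => |a n * r n|) (hd : ∀ n z, HasDerivAt (φ n) (r n * ψ n z) z)
    (hφ1 : ∀ n z, |φ n z| ≤ 1) (hψ1 : ∀ n z, |ψ n z| ≤ 1) (z : ℝ) :
    HasDerivAt (fun z => ∑' n, a n * φ n z) (∑' n, a n * r n * ψ n z) z := by
  refine hasDerivAt_tsum (g := fun n z => a n * φ n z) (g' := fun n z => a n * r n * ψ n z) har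
    (fun n z => ((hd n z).const_mul (a n)).congr_deriv (by ring)) (fun n z => ?_)
    (summable_mul_of_abs_le_one ha fun n => hφ1 n 0) z
  rw [norm_mul]
  exact mul_le_of_le_one_right (abs_nonneg _) (hψ1 n _)

/-- With zero boundary values `sineCoeff_deriv2` gives |coefficient| = |coefficient of W''| / freq²,
which is O(1/n²). -/
lemma IsC2Data.summable_sineCoeff {W W1 W2 : ℝ → ℝ} (h : IsC2Data W W1 W2) (h0 : W 0 = 0)
    (h1 : W 1 = 0) : Summable fun n => |sineCoeff W n| := by
  obtain ⟨C, hC⟩ := (isCompact_Icc (a := (0 : ℝ)) (b := 1)).exists_bound_of_continuousOn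
    h.cont2.continuousOn
  have hC0 : 0 ≤ C := (norm_nonneg _).trans (hC 0 ⟨le_rfl, zero_le_one⟩)
  have hbd : ∀ n, |sineCoeff W2 n| ≤ C := by
    intro n
    have := intervalIntegral.norm_integral_le_of_norm_le_const (a := (0 : ℝ)) (b := 1) (C := C)
      (f := fun z => W2 z * sin (freq n * z)) fun z hz => by
        rw [uIoc_of_le zero_le_one] at hz
        rw [norm_mul]
        exact (mul_le_of_le_one_right (norm_nonneg _) (abs_sin_le_one _)).trans
          (hC z ⟨hz.1.le, hz.2⟩)
    simpa [sineCoeff] using this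
  have hs := ((summable_nat_add_iff 1).2 (Real.summable_one_div_nat_pow.2 one_lt_two)).mul_left C
  refine hs.of_nonneg_of_le (fun _ => abs_nonneg _) fun n => ?_
  have hf := freq_pos n
  have e := h.sineCoeff_deriv2 n
  rw [h0, h1] at e
  have e2 : |sineCoeff W n| = |sineCoeff W2 n| / freq n ^ 2 := by
    rw [e, eq_div_iff (by positivity)]
    simp only [mul_zero, sub_self, zero_sub, abs_neg, abs_mul, abs_of_pos (pow_pos hf 2)]
    ring
  rw [e2, ← div_eq_mul_one_div]
  push_cast
  have h2 : ((n : ℝ) + 1) ≤ freq n := by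
    unfold freq
    exact le_mul_of_one_le_right (by positivity) (by linarith [pi_gt_three])
  gcongr
  exact hbd n

/-- A classical solution of the heat equation `x_t = D x_zz - c x` on the unit interval, together
with its derivatives, as functions on the whole line. -/
structure IsHeatSolution (D c : ℝ) (d x₀ : ℝ → ℝ) (x xt xz xzz : ℝ → ℝ → ℝ) : Prop where
  cont : ContinuousOn (Function.uncurry x) (Ici 0 ×ˢ univ)
  cont_t : ContinuousOn (Function.uncurry xt) (Ioi 0 ×ˢ univ)
  cont_z : ContinuousOn (Function.uncurry xz) (Ioi 0 ×ˢ univ)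
  cont_zz : ContinuousOn (Function.uncurry xzz) (Ioi 0 ×ˢ univ)
  deriv_t : ∀ t, 0 < t → ∀ z, HasDerivAt (fun t => x t z) (xt t z) t
  deriv_z : ∀ t, 0 < t → ∀ z, HasDerivAt (x t) (xz t z) z
  deriv_zz : ∀ t, 0 < t → ∀ z, HasDerivAt (xz t) (xzz t z) z
  pde : ∀ t, 0 < t → ∀ z ∈ Icc (0 : ℝ) 1, xt t z = D * xzz t z - c * x t z
  left : ∀ t, 0 ≤ t → x t 0 = d t
  right : ∀ t, 0 ≤ t → x t 1 = 0
  initial : ∀ z ∈ Icc (0 : ℝ) 1, x 0 z = x₀ z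

/-- A nonzero boundary value makes sine coefficients decay only like 1/n, too slowly to
differentiate the series. So write x = d(1-z) + gψ + v with g = d' + c d, D ψ'' = 1 - z and ψ(0) =
ψ(1) = 0. Then v has zero boundary values and v_t = D v_zz - c v - hψ with h = g' + c g, which is
continuous because d is C². Subtracting d(1-z) alone would leave a source proportional to 1 - z,
again with coefficients of order 1/n; those of ψ are summable. -/
lemma exists_heatSolution {D c : ℝ} (hD : 0 < D) (hc : 0 ≤ c) {d x₀ : ℝ → ℝ}
    (hd : ContDiffOn ℝ 2 d (Ici 0)) (hx₀ : ContDiffOn ℝ 2 x₀ (Icc 0 1)) (h0 : x₀ 0 = d 0)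
    (h1 : x₀ 1 = 0) : ∃ x xt xz xzz, IsHeatSolution D c d x₀ x xt xz xzz := by
  obtain ⟨f, f1, f2, hf, hfe⟩ := exists_C2Data_Ici hd
  obtain ⟨w, w1, w2, hw, hwe⟩ := exists_C2Data_Icc hx₀
  have cf := hf.cont
  have cf1 := hf.cont1
  have cf2 := hf.cont2
  -- quasi-static profiles
  set ψ : ℝ → ℝ := fun z => (z ^ 2 / 2 - z ^ 3 / 6 - z / 3) / D with hψ
  have hψd : IsC2Data ψ (fun z => (z - z ^ 2 / 2 - 1 / 3) / D) (fun z => (1 - z) / D) := by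
    refine ⟨fun z => ?_, fun z => ?_, by fun_prop⟩
    · refine ((((hasDerivAt_pow 2 z).div_const 2).sub ((hasDerivAt_pow 3 z).div_const 6)).sub
        ((hasDerivAt_id z).div_const 3)).div_const D |>.congr_deriv ?_
      norm_num; ring
    · refine ((((hasDerivAt_id z).sub ((hasDerivAt_pow 2 z).div_const 2)).sub_const
        (1 / 3)).div_const D).congr_deriv ?_
      norm_num
  have hψ0 : ψ 0 = 0 := by simp [hψ]
  have hψ1 : ψ 1 = 0 := by simp only [hψ]; norm_num
  set g : ℝ → ℝ := fun t => f1 t + c * f t with hg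
  have hgd : ∀ t, HasDerivAt g (f2 t + c * f1 t) t := fun t =>
    (hf.d2 t).add ((hf.d1 t).const_mul c)
  have cg : Continuous g := by fun_prop
  set h : ℝ → ℝ := fun t => f2 t + c * f1 t + c * g t with hh
  have ch : Continuous h := by fun_prop
  -- the initial remainder
  have hW := show IsC2Data (fun z => w z - f 0 * (1 - z) - g 0 * ψ z)
      (fun z => w1 z - f 0 * (-1) - g 0 * ((z - z ^ 2 / 2 - 1 / 3) / D))
      (fun z => w2 z - g 0 * ((1 - z) / D)) by
    refine ⟨fun z => ?_, fun z => ?_, ?_⟩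
    · exact ((hw.d1 z).sub (((hasDerivAt_id z).const_sub 1).const_mul (f 0))).sub
        ((hψd.d1 z).const_mul (g 0))
    · exact ((hw.d2 z).sub_const _).sub ((hψd.d2 z).const_mul (g 0))
    · have := hw.cont2
      fun_prop
  set W : ℝ → ℝ := fun z => w z - f 0 * (1 - z) - g 0 * ψ z with hWdef
  -- Zero-order compatibility suffices, since ψ vanishes at both ends; for t > 0 the exponential
  -- factors supply the missing decay.
  have hW0 : W 0 = 0 := by
    simp only [hWdef, hψ0, hwe (⟨le_rfl, zero_le_one⟩ : (0 : ℝ) ∈ Icc (0 : ℝ) 1), h0,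
      hfe (self_mem_Ici : (0 : ℝ) ∈ Ici 0)]; ring
  have hW1 : W 1 = 0 := by
    simp only [hWdef, hψ1, hwe (⟨zero_le_one, le_rfl⟩ : (1 : ℝ) ∈ Icc (0 : ℝ) 1), h1]; ring
  set b : ℕ → ℝ := fun n => 2 * sineCoeff W n with hb
  set e : ℕ → ℝ := fun n => 2 * sineCoeff ψ n with he
  have sb : Summable fun n => |b n| := by
    refine ((hW.summable_sineCoeff hW0 hW1).mul_left 2).congr fun n => ?_
    rw [hb, abs_mul, abs_two]
  have se : Summable fun n => |e n| := by
    refine ((hψd.summable_sineCoeff hψ0 hψ1).mul_left 2).congr fun n => ?_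
    rw [he, abs_mul, abs_two]
  have hbsum := tsum_sineCoeff_eq hW.cont.continuousOn (hW.summable_sineCoeff hW0 hW1)
  have hesum := tsum_sineCoeff_eq hψd.cont.continuousOn (hψd.summable_sineCoeff hψ0 hψ1)
  -- the modes
  set lam : ℕ → ℝ := fun n => c + D * freq n ^ 2 with hlamdef
  have hlamD : ∀ n, D * freq n ^ 2 ≤ lam n := fun n => by simp only [hlamdef]; linarith
  have hfreq2 : ∀ n, freq n ≤ freq n ^ 2 := fun n => by nlinarith [one_le_freq n]
  have hlam1 : ∀ n, D ≤ lam n := fun n => by nlinarith [one_le_freq n, hfreq2 n, hlamD n]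
  have hlam : ∀ n, 0 < lam n := fun n => hD.trans_le (hlam1 n)
  set a : ℕ → ℝ → ℝ := fun n t => heatMode h (lam n) (b n) (e n) t with ha
  have ca : ∀ n, Continuous (a n) := fun n => continuous_heatMode ch _ _ _
  have hbound : ∀ T : ℝ, ∃ M, 0 ≤ M ∧ ∀ t ∈ Icc 0 T, |h t| ≤ M := fun T => by
    obtain ⟨M, hM⟩ := (isCompact_Icc (a := (0 : ℝ)) (b := T)).exists_bound_of_continuousOn
      ch.continuousOn
    exact ⟨max M 0, le_max_right _ _, fun t ht => (hM t ht).trans (le_max_left _ _)⟩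
  have lsla : LocallySummable fun n t => lam n * a n t := by
    intro T hT
    obtain ⟨M, hM0, hM⟩ := hbound (T + 1)
    refine ⟨fun n => (T / 2)⁻¹ * |b n| + M * |e n|, (sb.mul_left _).add (se.mul_left _),
      fun n t ht => ?_⟩
    have ht0 : T / 2 < t := ht.1
    have hbd := abs_heatMode_le (b := b n) (e := e n) ch (hlam n) hM (t := t)
      ⟨by linarith, ht.2.le⟩
    -- From x ≤ e^x with x = lam t and t > T/2: the smoothing estimate lam e^(-lam t) ≤ 2/T.
    have hexp : lam n * exp (-lam n * t) ≤ (T / 2)⁻¹ := by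
      have h3 : lam n * (T / 2) ≤ exp (lam n * t) := by
        have := add_one_le_exp (lam n * t)
        have := mul_le_mul_of_nonneg_left ht0.le (hlam n).le
        linarith
      rw [neg_mul, exp_neg, ← div_eq_mul_inv, div_le_iff₀ (exp_pos _), inv_mul_eq_div,
        le_div_iff₀ (by positivity)]
      exact h3
    rw [abs_mul, abs_of_pos (hlam n)]
    calc lam n * |a n t| ≤ lam n * (exp (-lam n * t) * |b n| + |e n| * (M / lam n)) :=
          mul_le_mul_of_nonneg_left hbd (hlam n).le
      _ = lam n * exp (-lam n * t) * |b n| + M * |e n| := by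
          have := (hlam n).ne'
          field_simp
      _ ≤ (T / 2)⁻¹ * |b n| + M * |e n| := by gcongr
  have lsC : ∀ r : ℕ → ℝ, (∀ n, |r n| ≤ D⁻¹ * lam n) → LocallySummable fun n t => a n t * r n :=
    fun r hr => lsla.of_abs_le D⁻¹ (by positivity) fun n t => by
      rw [abs_mul, abs_mul, abs_of_pos (hlam n)]
      calc |a n t| * |r n| ≤ |a n t| * (D⁻¹ * lam n) :=
            mul_le_mul_of_nonneg_left (hr n) (abs_nonneg _)
        _ = _ := by ring
  have hr2 : ∀ n, freq n ^ 2 ≤ D⁻¹ * lam n := fun n => by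
    rw [inv_mul_eq_div, le_div_iff₀ hD]; linarith [hlamD n]
  have lsz : LocallySummable fun n t => a n t * freq n := lsC _ fun n => by
    rw [abs_of_pos (freq_pos n)]; exact (hfreq2 n).trans (hr2 n)
  have lszz : LocallySummable fun n t => a n t * freq n * (-freq n) := by
    refine (lsC (fun n => -freq n ^ 2) fun n => ?_).of_abs_le 1 zero_le_one fun n t => ?_
    · rw [abs_neg, abs_of_nonneg (sq_nonneg _)]; exact hr2 n
    · rw [one_mul]; apply le_of_eq; congr 1; ring
  have lsa : LocallySummable a := by
    refine (lsC (fun _ => 1) fun n => ?_).of_abs_le 1 zero_le_one fun n t => ?_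
    · rw [abs_one]; exact (by nlinarith [one_le_freq n, hfreq2 n] : 1 ≤ freq n ^ 2).trans (hr2 n)
    · rw [one_mul, mul_one]
  have lst : LocallySummable fun n t => -lam n * a n t - e n * h t := by
    have h3 : LocallySummable fun n t => e n * h t := by
      intro T hT
      obtain ⟨M, hM0, hM⟩ := hbound (T + 1)
      refine ⟨fun n => |e n| * M, se.mul_right _, fun n t ht => ?_⟩
      rw [abs_mul]
      exact mul_le_mul_of_nonneg_left (hM t ⟨by linarith [ht.1], ht.2.le⟩) (abs_nonneg _)
    refine (lsla.add h3).of_abs_le 1 zero_le_one fun n t => ?_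
    rw [one_mul, ← abs_neg]; apply le_of_eq; congr 1; ring
  have hs1 : ∀ n z, |sin (freq n * z)| ≤ 1 := fun n z => abs_sin_le_one _
  have hc1 : ∀ n z, |cos (freq n * z)| ≤ 1 := fun n z => abs_cos_le_one _
  have csin : ∀ n, Continuous fun z => sin (freq n * z) := fun n => by fun_prop
  have ccos : ∀ n, Continuous fun z => cos (freq n * z) := fun n => by fun_prop
  have hlin : ∀ n z, HasDerivAt (fun z => freq n * z) (freq n) z := fun n z => by
    simpa using (hasDerivAt_id z).const_mul (freq n)
  have dsin : ∀ n z, HasDerivAt (fun z => sin (freq n * z)) (freq n * cos (freq n * z)) z :=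
    fun n z => (hlin n z).sin.congr_deriv (by ring)
  have dcos : ∀ n z, HasDerivAt (fun z => cos (freq n * z)) (-freq n * sin (freq n * z)) z :=
    fun n z => (hlin n z).cos.congr_deriv (by ring)
  refine ⟨fun t z => f t * (1 - z) + g t * ψ z + ∑' n, a n t * sin (freq n * z),
    fun t z => f1 t * (1 - z) + (f2 t + c * f1 t) * ψ z +
      ∑' n, (-lam n * a n t - e n * h t) * sin (freq n * z),
    fun t z => f t * (-1) + g t * ((z - z ^ 2 / 2 - 1 / 3) / D) +
      ∑' n, a n t * freq n * cos (freq n * z),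
    fun t z => g t * ((1 - z) / D) + ∑' n, a n t * freq n * (-freq n) * sin (freq n * z),
    ?_, ?_, ?_, ?_, ?_, ?_, ?_, ?_, ?_, ?_, ?_⟩
  · refine ContinuousOn.add (Continuous.continuousOn (by simp only [hψ]; fun_prop))
      (continuousOn_series ca csin hs1 fun T hT => ?_)
    obtain ⟨M, hM0, hM⟩ := hbound (T + 1)
    -- Up to t = 0 only the modes themselves are dominated, using e^(-lam t) ≤ 1 and lam ≥ D; no
    -- factor lam can be afforded there.
    refine ⟨Iio (T + 1), isOpen_Iio, by simp, fun n => |b n| + |e n| * (M / D),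
      sb.add (se.mul_right _), fun n t ht => ?_⟩
    have ht0 : 0 ≤ t := ht.1
    refine (abs_heatMode_le ch (hlam n) hM ⟨ht0, ht.2.le⟩).trans ?_
    have h3 : exp (-lam n * t) ≤ 1 := exp_le_one_iff.2 (by nlinarith [hlam n])
    have h4 := hlam1 n
    refine add_le_add (mul_le_of_le_one_left (abs_nonneg _) h3) ?_
    gcongr
  · exact ContinuousOn.add (Continuous.continuousOn (by simp only [hψ]; fun_prop))
      (lst.continuousOn_series (fun n => by have := ca n; fun_prop) csin hs1)
  · exact ContinuousOn.add (Continuous.continuousOn (by fun_prop))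
      (lsz.continuousOn_series (fun n => by have := ca n; fun_prop) ccos hc1)
  · exact ContinuousOn.add (Continuous.continuousOn (by fun_prop))
      (lszz.continuousOn_series (fun n => by have := ca n; fun_prop) csin hs1)
  · intro t ht z
    exact (((hf.d1 t).mul_const _).add ((hgd t).mul_const _)).add
      (lsa.hasDerivAt_time lst (fun n t => hasDerivAt_heatMode ch _ _ _ t) hs1 ht z)
  · intro t ht z
    exact ((((hasDerivAt_id z).const_sub 1).const_mul (f t)).add ((hψd.d1 z).const_mul (g t))).add
      (hasDerivAt_series_space (lsa.summable ht) (lsz.summable ht) dsin hs1 hc1 z)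
  · intro t ht z
    refine ((((hψd.d2 z).const_mul (g t)).const_add (f t * (-1)))).add
      (hasDerivAt_series_space (lsz.summable ht) (lszz.summable ht) dcos hc1 hs1 z)
  · intro t ht z hz
    have s1 : Summable fun n => a n t * sin (freq n * z) :=
      summable_mul_of_abs_le_one (lsa.summable ht) fun n => hs1 n z
    have s2 : Summable fun n => a n t * freq n * (-freq n) * sin (freq n * z) :=
      summable_mul_of_abs_le_one (lszz.summable ht) fun n => hs1 n z
    have s3 : Summable fun n => e n * sin (freq n * z) :=
      summable_mul_of_abs_le_one se fun n => hs1 n z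
    -- The sine series represents ψ on [0,1] only, which is why the equation is claimed just there.
    have hE : HasSum (fun n => e n * sin (freq n * z)) (ψ z) := by
      rw [← hesum z hz]; exact s3.hasSum
    have key : ∑' n, (-lam n * a n t - e n * h t) * sin (freq n * z) =
        D * (∑' n, a n t * freq n * (-freq n) * sin (freq n * z)) -
          c * (∑' n, a n t * sin (freq n * z)) - h t * ψ z := by
      refine HasSum.tsum_eq ?_
      convert! ((s2.hasSum.mul_left D).sub (s1.hasSum.mul_left c)).sub (hE.mul_left (h t)) using 1
      funext n
      simp only [hlamdef]
      ring
    simp only [key]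
    simp only [hh, hg]
    field_simp
    ring
  · intro t ht
    simp only [mul_zero, sin_zero, tsum_zero, hψ0, sub_zero, mul_one, add_zero]
    exact hfe ht
  · intro t _
    simp only [mul_one, sin_freq, mul_zero, tsum_zero, hψ1, sub_self, add_zero]
  · intro z hz
    have h3 : ∀ n, a n 0 = 2 * sineCoeff W n := fun n => by
      simp [ha, heatMode, duhamel, hb]
    simp only [h3]
    rw [hbsum z hz, ← hwe hz]
    simp only [hWdef]
    ring

/-! ### Return to the closed loop -/

/-- A function with continuous partial derivatives on an open set is of class `C¹`. -/
lemma contDiffOn_one_of_partial {f f1 f2 : ℝ → ℝ → ℝ} {U : Set (ℝ × ℝ)} (hU : IsOpen U)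
    (h1 : ContinuousOn (Function.uncurry f1) U) (h2 : ContinuousOn (Function.uncurry f2) U)
    (d1 : ∀ q ∈ U, HasDerivAt (fun t => f t q.2) (f1 q.1 q.2) q.1)
    (d2 : ∀ q ∈ U, HasDerivAt (f q.1) (f2 q.1 q.2) q.2) :
    ContDiffOn ℝ 1 (Function.uncurry f) U := by
  set Λ := ContinuousLinearMap.toSpanSingletonCLE (𝕜 := ℝ) (E := ℝ)
  have c1 : ContinuousOn (fun q : ℝ × ℝ => Λ (f1 q.1 q.2)) U :=
    Λ.continuous.comp_continuousOn h1
  have c2 : ContinuousOn (fun q : ℝ × ℝ => Λ (f2 q.1 q.2)) U :=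
    Λ.continuous.comp_continuousOn h2
  have key : ∀ q ∈ U, HasFDerivAt (Function.uncurry f)
      ((Λ (f1 q.1 q.2)).coprod (Λ (f2 q.1 q.2))) q := by
    intro q hq
    exact (hasStrictFDerivAt_uncurry_coprod (𝕜 := ℝ) (u := q) (f := f)
      (f₁ := fun t z => Λ (f1 t z)) (f₂ := fun t z => Λ (f2 t z))
      (Filter.eventually_of_mem (hU.mem_nhds hq) fun r hr => (d1 r hr).hasFDerivAt)
      (Filter.eventually_of_mem (hU.mem_nhds hq) fun r hr => (d2 r hr).hasFDerivAt)
      (c1.continuousAt (hU.mem_nhds hq)) (c2.continuousAt (hU.mem_nhds hq))).hasFDerivAt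
  rw [show (1 : WithTop ℕ∞) = 0 + 1 by norm_num, contDiffOn_succ_iff_fderiv_of_isOpen hU]
  refine ⟨fun q hq => (key q hq).differentiableAt.differentiableWithinAt, by simp, ?_⟩
  rw [contDiffOn_zero]
  have cc : ContinuousOn (fun q : ℝ × ℝ => (Λ (f1 q.1 q.2)).coprod (Λ (f2 q.1 q.2))) U := by
    have := (ContinuousLinearMap.coprodEquivL ℝ).continuous.comp_continuousOn (c1.prodMk c2)
    exact this
  exact cc.congr fun q hq => (key q hq).fderiv

/-- The inverse transformation maps solutions of the target system to solutions of the
closed loop. -/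
lemma IsHeatSolution.isClosedLoopSolution {D p c : ℝ} {k l : ℝ → ℝ → ℝ} {d y₀ : ℝ → ℝ}
    {x xt xz xzz : ℝ → ℝ → ℝ} (hk : IsBacksteppingKernel D p c k) (hl : IsInverseKernel k l)
    (hy₀ : ContDiffOn ℝ 2 y₀ (Icc 0 1))
    (hx : IsHeatSolution D c d (volterra k y₀) x xt xz xzz) :
    ∃ y, IsClosedLoopSolution D p k d y₀ y := by
  obtain ⟨L, L1, L2, hL, hL1, hL2, hLd, hLd1, he⟩ := hl.1.exists_extension
  set y : ℝ → ℝ → ℝ := fun t z => volterra L (x t) z with hydef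
  have sub0 : (Ici (0 : ℝ) ×ˢ Icc (0 : ℝ) 1) ⊆ Ici 0 ×ˢ univ := prod_mono Subset.rfl (subset_univ _)
  have slice0 : ∀ t, 0 ≤ t → Continuous (x t) := fun t ht =>
    hx.cont.comp_continuous (f := fun s => (t, s)) (by fun_prop) fun s => ⟨ht, mem_univ _⟩
  have slicet : ∀ t, 0 < t → Continuous (xt t) := fun t ht =>
    hx.cont_t.comp_continuous (f := fun s => (t, s)) (by fun_prop) fun s => ⟨ht, mem_univ _⟩
  have slicezz : ∀ t, 0 < t → Continuous (xzz t) := fun t ht =>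
    hx.cont_zz.comp_continuous (f := fun s => (t, s)) (by fun_prop) fun s => ⟨ht, mem_univ _⟩
  have hdata : ∀ t, 0 < t → IsC2Data (x t) (xz t) (xzz t) := fun t ht =>
    ⟨hx.deriv_z t ht, hx.deriv_zz t ht, slicezz t ht⟩
  have hyl : ∀ t, EqOn (y t) (volterra l (x t)) (Icc 0 1) := fun t z hz =>
    (volterra_congr he (fun _ _ => rfl) hz).symm
  have hxy : ∀ t, 0 ≤ t → ∀ z ∈ Icc (0 : ℝ) 1, x t z = volterra k (y t) z := fun t ht =>
    (hl.2 (x t) (y t) (slice0 t ht).continuousOn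
      (continuous_volterra hL (slice0 t ht)).continuousOn).2 (hyl t)
  have hinit : EqOn (y 0) y₀ (Icc 0 1) := by
    have h1 := (hl.2 _ _ (continuousOn_volterra hk.1 hy₀.continuousOn) hy₀.continuousOn).1
      fun _ _ => rfl
    intro z hz
    rw [hyl 0 hz, h1 z hz]
    exact volterra_congr (fun _ _ _ _ => rfl) (fun w hw => (hx.initial w hw).symm) hz
  have hprof : ∀ t, 0 ≤ t → ContDiffOn ℝ 2 (y t) (Icc 0 1) := by
    intro t ht
    -- At t = 0 the series gives no second derivative in z; there the profile is y₀, which is C² by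
    -- assumption.
    rcases ht.eq_or_lt with rfl | ht
    · exact hy₀.congr hinit
    · exact (contDiffOn_volterra hl.1 (hdata t ht).contDiff.contDiffOn).congr (hyl t)
  have hyt : ∀ t, 0 < t → ∀ z, HasDerivAt (fun t => y t z) (volterra L (xt t) z) t := by
    intro t ht z
    have cLz : Continuous (L z) := by fun_prop
    refine (hx.deriv_t t ht z).add (hasDerivAt_integral_param (f := fun t s => L z s * x t s)
      (f' := fun t s => L z s * xt t s) isOpen_Ioi (fun t ht => ?_) ?_
      (fun t ht s _ => (hx.deriv_t t ht s).const_mul _) ht)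
    · have := slice0 t (le_of_lt ht)
      fun_prop
    · exact ContinuousOn.mul (by fun_prop) (hx.cont_t.mono (prod_mono Subset.rfl (subset_univ _)))
  have hyz : ∀ t, 0 < t → ∀ z, HasDerivAt (y t)
      (xz t z + (-(L z z * x t z) + ∫ s in z..1, L1 z s * x t s)) z := fun t ht z =>
    (hx.deriv_z t ht z).add (hasDerivAt_integral_kernel hL hL1 hLd (slice0 t ht.le) z)
  have hxpos : ContinuousOn (Function.uncurry x) (Ioi 0 ×ˢ univ) :=
    hx.cont.mono (prod_mono Ioi_subset_Ici_self Subset.rfl)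
  refine ⟨y, ⟨?_, ?_, hprof, ?_, ?_, ?_, hinit⟩⟩
  · exact (hx.cont.add (continuousOn_integral_kernel hx.cont hL)).mono sub0
  · have hc1 : ContinuousOn (Function.uncurry fun t z => volterra L (xt t) z) (Ioi 0 ×ˢ univ) :=
      hx.cont_t.add (continuousOn_integral_kernel hx.cont_t hL)
    have hc2 : ContinuousOn (Function.uncurry fun t z => xz t z + (-(L z z * x t z) +
        ∫ s in z..1, L1 z s * x t s)) (Ioi 0 ×ˢ univ) := by
      refine hx.cont_z.add (ContinuousOn.add (ContinuousOn.neg (ContinuousOn.mul ?_ hxpos))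
        (continuousOn_integral_kernel hxpos hL1))
      exact Continuous.continuousOn (by fun_prop)
    exact (contDiffOn_one_of_partial (f := y) (isOpen_Ioi.prod isOpen_univ) hc1 hc2
      (fun q hq => hyt q.1 hq.1 q.2) (fun q hq => hyz q.1 hq.1 q.2)).mono
      (prod_mono Subset.rfl (subset_univ _))
  · intro t ht z hz
    rw [(hyt t ht z).deriv]
    obtain ⟨Y, Y1, Y2, hY, hYe⟩ := exists_C2Data_Icc (hprof t ht.le)
    have cY := hY.cont
    have cY2 := hY.cont2
    have hy2 : ∀ s ∈ Ioo (0 : ℝ) 1, deriv (deriv (y t)) s = Y2 s := fun s hs =>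
      hY.deriv2 isOpen_Ioo (fun r hr => (hYe (Ioo_subset_Icc_self hr)).symm) hs
    have hright : y t 1 = 0 := by
      simp only [hydef, volterra, hx.right t ht.le, intervalIntegral.integral_same, add_zero]
    have cR : Continuous fun s => D * Y2 s + p * Y s := by fun_prop
    have hIoo : EqOn (xt t) (volterra k fun s => D * Y2 s + p * Y s) (Ioo 0 1) := by
      intro r hr
      have hrI := Ioo_subset_Icc_self hr
      have h1 := hk.2 (y t) (hprof t ht.le) hright r hr
      rw [(hdata t ht).deriv2 isOpen_Ioo
        (fun s hs => (hxy t ht.le s (Ioo_subset_Icc_self hs)).symm) hr,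
        ← hxy t ht.le r hrI, ← hx.pde t ht r hrI] at h1
      rw [h1]
      unfold volterra
      beta_reduce
      rw [hy2 r hr, hYe hrI]
      congr 1
      rw [integral_of_le hr.2.le, integral_of_le hr.2.le, integral_Ioc_eq_integral_Ioo,
        integral_Ioc_eq_integral_Ioo]
      refine setIntegral_congr_fun measurableSet_Ioo fun s hs => ?_
      have hs' : s ∈ Ioo (0 : ℝ) 1 := ⟨hr.1.trans hs.1, hs.2⟩
      simp only [hy2 s hs', hYe (Ioo_subset_Icc_self hs')]
    -- The inverse relation needs equality on all of [0,1], so the identity is extended by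
    -- continuity. With the continuous Y2 in place of y'', it says x_t = T_k(D y'' + p y); applying
    -- T_l and y_t = T_l x_t gives the equation for y.
    have hIcc : EqOn (xt t) (volterra k fun s => D * Y2 s + p * Y s) (Icc 0 1) :=
      hIoo.of_subset_closure (slicet t ht).continuousOn
        (continuousOn_volterra hk.1 cR.continuousOn) Ioo_subset_Icc_self
        (closure_Ioo (zero_ne_one (α := ℝ))).ge
    have h2 := (hl.2 (xt t) _ (slicet t ht).continuousOn cR.continuousOn).1 hIcc z
      (Ioo_subset_Icc_self hz)
    rw [hy2 z hz, ← hYe (Ioo_subset_Icc_self hz), h2]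
    exact (volterra_congr he (fun _ _ => rfl) (Ioo_subset_Icc_self hz)).symm
  · intro t ht
    have h1 := hxy t ht 0 ⟨le_rfl, zero_le_one⟩
    rw [hx.left t ht, volterra] at h1
    linarith
  · intro t ht
    simp only [hydef, volterra, hx.right t ht, intervalIntegral.integral_same, add_zero]

end BoundaryISS

/-! ### Assembly of the theorem -/

theorem mainTheorem6 (D p c : ℝ) (hD : 0 < D) (hc : 0 ≤ c) :
    -- the two expressions for the gain agree
    (0 < c → BoundaryISS.gain D c =
      1 / (Real.exp (2 * √(c / D)) - 1) *
        √((Real.exp (4 * √(c / D)) - 1 - 4 * √(c / D) * Real.exp (2 * √(c / D))) /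
          (2 * √(c / D)))) ∧
    (c = 0 → BoundaryISS.gain D c = 1 / √3) ∧
    -- the kernels of the direct and of the inverse backstepping transformation exist
    (∃ k l : ℝ → ℝ → ℝ,
      BoundaryISS.IsBacksteppingKernel D p c k ∧ BoundaryISS.IsInverseKernel k l) ∧
    -- well-posedness and the ISS estimate
    ∀ k l : ℝ → ℝ → ℝ,
      BoundaryISS.IsBacksteppingKernel D p c k → BoundaryISS.IsInverseKernel k l →
      ∀ d y₀ : ℝ → ℝ, ContDiffOn ℝ 2 d (Set.Ici 0) → ContDiffOn ℝ 2 y₀ (Set.Icc 0 1) →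
        y₀ 0 = d 0 - ∫ s in (0 : ℝ)..1, k 0 s * y₀ s → y₀ 1 = 0 →
        ∃ y : ℝ → ℝ → ℝ,
          BoundaryISS.IsClosedLoopSolution D p k d y₀ y ∧
          (∀ y' : ℝ → ℝ → ℝ, BoundaryISS.IsClosedLoopSolution D p k d y₀ y' →
            ∀ t, 0 ≤ t → ∀ z ∈ Set.Icc (0 : ℝ) 1, y' t z = y t z) ∧
          ∀ t ε : ℝ, 0 ≤ t → 0 < ε →
            BoundaryISS.l2norm (y t) ≤
              Real.exp (-(c + D * Real.pi ^ 2) * t) * (1 + BoundaryISS.kernelNorm l) *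
                  (1 + BoundaryISS.kernelNorm k) * BoundaryISS.l2norm y₀ * √(1 + ε) +
                (1 + BoundaryISS.kernelNorm l) * √(1 + ε⁻¹) * BoundaryISS.gain D c *
                  sSup ((fun s => |d s|) '' Set.Icc 0 t) := by
  refine ⟨fun hc' => BoundaryISS.gain_of_pos hD hc', fun h0 => h0 ▸ BoundaryISS.gain_zero D,
    ⟨_, _, BoundaryISS.isBacksteppingKernel_besselKernel hD.ne' p c,
      BoundaryISS.isInverseKernel_besselKernel _⟩, fun k l hk hl d y₀ hd hy₀ h0 h1 => ?_⟩
  -- The compatibility of y₀ with the feedback is x₀(0) = d(0) for x₀ = T_k y₀.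
  obtain ⟨x, xt, xz, xzz, hx⟩ := BoundaryISS.exists_heatSolution hD hc hd
    (BoundaryISS.contDiffOn_volterra hk.1 hy₀)
    (by rw [BoundaryISS.volterra, h0]; ring) (by simp [BoundaryISS.volterra, h1])
  obtain ⟨y, hy⟩ := hx.isClosedLoopSolution hk hl hy₀
  exact ⟨y, hy, fun y' hy' t ht => hy.unique hD hc hk hl hy' ht,
    fun t ε ht hε => hy.l2norm_le hD hc hk hl hd.continuousOn ht hε⟩
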